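/- Let $\Omega_0=\{x\in\mathbb R^3:|x|\le 1\}$, $\Omega=\mathbb R^3\setminus\Omega_0$, let $\mathbf e_1$ be the first vector of the canonical basis of $\mathbb R^3$, and $\mathbb D(\mathbf v)=\tfrac12(\nabla\mathbf v+(\nabla\mathbf v)^\top)$. Let $\mathcal C(\mathbb R^3)$ be the class of divergence-free fields $\boldsymbol\varphi\in C_0^\infty(\mathbb R^3;\mathbb R^3)$ for which there are vectors $\widehat{\boldsymbol\varphi}_1,\widehat{\boldsymbol\varphi}_2\in\mathbb R^3$ such that $\boldsymbol\varphi(x)=\widehat{\boldsymbol\varphi}_1+\widehat{\boldsymbol\varphi}_2\times x$ in a neighborhood of $\Omega_0$, and let $\mathcal V(\mathbb R^3)$ be the completion of $\mathcal C(\mathbb R^3)$ in the norm $\|\mathbb D(\cdot)\|_{L^2(\mathbb R^3)}$, realized as a space of fields in $L^6(\mathbb R^3)$ with weak gradient in $L^2(\mathbb R^3)$. Every $\mathbf v\in\mathcal V(\mathbb R^3)$ satisfies $\mathbf v(x)=\widehat{\mathbf v}_1+\widehat{\mathbf v}_2\times x$ for a.e. $x\in\Omega_0$, with uniquely determined $\widehat{\mathbf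 v}_1,\widehat{\mathbf v}_2\in\mathbb R^3$. For $\lambda>0$, consider the steady free-fall problem $$\lambda(\mathbf v-\boldsymbol\tau)\cdot\nabla\mathbf v=\Delta\mathbf v-\nabla p,\quad \operatorname{div}\mathbf v=0\ \text{ in }\Omega,\qquad \mathbf v=\boldsymbol\tau+\boldsymbol\omega\times x\ \text{ on }\partial\Omega,\quad \lim_{|x|\to\infty}\mathbf v(x)=\mathbf 0,$$ $$\int_{\partial\Omega}\mathbb T(\mathbf v,p)\cdot\mathbf n=\lambda\mathbf e_1,\qquad \int_{\partial\Omega}x\times\mathbb T(\mathbf v,p)\cdot\mathbf n=\mathbf 0,\qquad \mathbb T(\mathbf v,p)=-p\mathbf 1+2\mathbb D(\mathbf v),$$ where $\mathbf n$ is the unit normal on $\partial\Omega$ exterior to $\Omega$. A field $\mathbf v:\mathbb R^3\to\mathbb R^3$ is a weak solution of this problem if $\mathbf v\in\mathcal V(\mathbb R^3)$, its translational velocity $\boldsymbol\tau:=\widehat{\mathbf v}_1$ is nonzero, and $$2\int_\Omega\mathbb D(\mathbf v):\mathbb D(\boldsymbol\varphi)\,dx-\lambda\,\widehat{\boldsymbol\varphi}_1\cdot\mathbf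 e_1=\lambda\int_{\mathbb R^3}\big((\boldsymbol\tau-\mathbf v)\cdot\nabla\mathbf v\big)\cdot\boldsymbol\varphi\,dx\qquad\text{for all }\boldsymbol\varphi\in\mathcal C(\mathbb R^3).$$ **Theorem.** For every $\lambda>0$ the steady free-fall problem has at least one weak solution $\mathbf v\in\mathcal V(\mathbb R^3)$ (in particular $\boldsymbol\tau=\widehat{\mathbf v}_1\neq\mathbf 0$) that satisfies the energy inequality $$2\,\|\mathbb D(\mathbf v)\|_{L^2(\mathbb R^3)}^2\le\lambda\,\boldsymbol\tau\cdot\mathbf e_1 .$$ -/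

import Mathlib

open scoped ContDiff Topology Matrix

namespace FreeFall

noncomputable section

open MeasureTheory Filter

/-- Three-dimensional Euclidean space. -/
abbrev E3 := EuclideanSpace ℝ (Fin 3)

/-- The unit vectors of the frame; the direction of gravity `e₁` is `e 0`. -/
def e (i : Fin 3) : E3 := EuclideanSpace.single i 1

/-- The sphere `Ω₀`: the closed unit ball centred at the origin. -/
def body : Set E3 := Metric.closedBall 0 1

/-- The liquid domain `Ω = ℝ³ \ Ω₀`. -/
def liquid : Set E3 := bodyᶜ

/-- The rigid velocity field `x ↦ a + b × x`. -/
def rigid (a b : E3) (x : E3) : E3 := a + WithLp.toLp 2 (crossProduct b.ofLp x.ofLp)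

/-- The classical gradient, `(∇φ)ᵢⱼ = ∂ⱼ φᵢ`. -/
def grad (φ : E3 → E3) (x : E3) : Matrix (Fin 3) (Fin 3) ℝ :=
  Matrix.of fun i j => (fderiv ℝ φ x (e j)) i

/-- The symmetric part of a matrix, so that `𝔻(v) = sym (∇v)`. -/
def sym (A : Matrix (Fin 3) (Fin 3) ℝ) : Matrix (Fin 3) (Fin 3) ℝ :=
  (1 / 2 : ℝ) • (A + Aᵀ)

/-- The contraction `A : B = ∑ᵢⱼ Aᵢⱼ Bᵢⱼ`. -/
def ddot (A B : Matrix (Fin 3) (Fin 3) ℝ) : ℝ := ∑ i, ∑ j, A i j * B i j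

/-- `φ ∈ 𝒞(ℝ³)` with characteristic vectors `a`, `b`: a smooth, compactly supported,
divergence-free field that equals `a + b × x` in a neighbourhood of the sphere. -/
structure IsTestField (φ : E3 → E3) (a b : E3) : Prop where
  smooth : ContDiff ℝ ∞ φ
  compact : HasCompactSupport φ
  rigid_near : ∀ᶠ x in 𝓝ˢ body, φ x = rigid a b x
  div_free : ∀ x, (grad φ x).trace = 0

/-- The class `𝒞(ℝ³)`. -/
def testFields : Set (E3 → E3) := {φ | ∃ a b, IsTestField φ a b}

/-- `G` is the weak gradient of `v` on `ℝ³`, with `Gᵢⱼ = ∂ⱼ vᵢ`. -/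
structure HasWeakGrad (v : E3 → E3) (G : E3 → Matrix (Fin 3) (Fin 3) ℝ) : Prop where
  locInt : LocallyIntegrable v volume
  locInt_grad : ∀ i j, LocallyIntegrable (fun x => G x i j) volume
  byParts : ∀ ψ : E3 → ℝ, ContDiff ℝ ∞ ψ → HasCompactSupport ψ → ∀ i j,
    ∫ x, v x i * fderiv ℝ ψ x (e j) = - ∫ x, G x i j * ψ x

/-- `v ∈ 𝒱(ℝ³)`, the completion of `𝒞(ℝ³)` in the norm `‖𝔻(·)‖₂`. By the Sobolev and Korn
inequalities this norm dominates the norms of `v` in `L⁶` and of `∇v` in `L²` on `𝒞(ℝ³)`, so the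
completion is realized as the set of `L⁶` fields with a square-integrable weak gradient that are
limits, in `L⁶` and with respect to `‖𝔻(·)‖₂`, of a sequence in `𝒞(ℝ³)`. -/
def MemV (v : E3 → E3) : Prop :=
  MemLp v 6 volume ∧ ∃ G : E3 → Matrix (Fin 3) (Fin 3) ℝ, HasWeakGrad v G ∧
    (∀ i j, MemLp (fun x => G x i j) 2 volume) ∧
    ∃ φ : ℕ → E3 → E3, (∀ n, φ n ∈ testFields) ∧
      Tendsto (fun n => eLpNorm (fun x => v x - φ n x) 6 volume) atTop (𝓝 0) ∧
      ∀ i j, Tendsto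
        (fun n => eLpNorm (fun x => sym (G x) i j - sym (grad (φ n) x) i j) 2 volume)
        atTop (𝓝 0)

/-- `τ`, `om` are the characteristic vectors of `v`: `v = τ + om × x` a.e. in the sphere.
They are uniquely determined by `v`. -/
def HasCharVectors (v : E3 → E3) (τ om : E3) : Prop :=
  ∀ᵐ x ∂(volume.restrict body), v x = rigid τ om x

/-- `v` is a weak solution of the steady free-fall problem at Galilei number `lam`; `G` is its weak
gradient and `τ`, `om` are its characteristic vectors (all three are determined by `v`).
The vector `((τ - v) · ∇v)ᵢ = ∑ⱼ (τ - v)ⱼ ∂ⱼ vᵢ` is `G *ᵥ (τ - v)`. -/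
structure IsWeakSolution (lam : ℝ) (v : E3 → E3) (G : E3 → Matrix (Fin 3) (Fin 3) ℝ)
    (τ om : E3) : Prop where
  memV : MemV v
  weakGrad : HasWeakGrad v G
  charVectors : HasCharVectors v τ om
  trans_ne_zero : τ ≠ 0
  weak_eq : ∀ (φ : E3 → E3) (a b : E3), IsTestField φ a b →
    2 * (∫ x in liquid, ddot (sym (G x)) (sym (grad φ x))) - lam * inner ℝ a (e 0) =
      lam * ∫ x, (G x *ᵥ (τ - v x).ofLp) ⬝ᵥ (φ x).ofLp

end

end FreeFall

namespace FreeFall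

noncomputable section

open MeasureTheory Filter

/-! The proof is a Galerkin scheme in the closure `GradSpace` of the gradients of test fields in
`L²`. For divergence-free test fields `∫ ∇u : (∇v)ᵀ = 0`, so `2 ∫ 𝔻(u) : 𝔻(v) = ∫ ∇u : ∇v`
(`two_mul_integral_ddot_sym`): the Dirichlet inner product is the viscous form, and Korn's
inequality becomes an identity. The Sobolev inequality bounds the `L⁶` norm by the Dirichlet norm,
and finite-dimensionality of the rigid fields bounds the characteristic vectors, so `velocity` and
`charVec` extend continuously to `GradSpace`.

The convective form vanishes on the diagonal (`convForm_self`). On the span of finitely many test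
fields the approximate equation is therefore a quadratic vector field that points outwards on large
spheres, and it has a zero (`exists_zero_of_inner_pos`, a Brouwer-type statement obtained from the
change of variables formula). The approximations obey the energy equality and a uniform bound, hence
converge weakly along an ultrafilter finer than `atTop` on finite sets of test fields.

To pass to the limit in the quadratic term, weak convergence of gradients is upgraded to strong `L²`
convergence of the velocities against a compactly supported weight (`WeakTendsto.mulComp`), by a
Poincaré inequality on the cubes of a fine grid. Weak lower semicontinuity of the norm turns the
energy equality into the inequality.

Finally `τ ≠ 0`: if `τ = 0`, the energy inequality forces the gradient to vanish, and a test field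
with translational velocity `e₁` then yields `0 = λ`. -/

/-! ### Zeros of coercive vector fields on finite-dimensional spaces -/

section Degree

variable {E : Type*} [NormedAddCommGroup E] [InnerProductSpace ℝ E] [FiniteDimensional ℝ E]

/-- If the evaluations at small parameters of a family of polynomials of bounded degree have a
constant integral, then so has the evaluation at `1`. -/
theorem integral_eval_one_eq_of_small {X : Type*} [MeasurableSpace X] {μ : Measure X}
    (p : X → Polynomial ℝ) (d : ℕ) (hd : ∀ x, (p x).natDegree ≤ d) {t₀ c : ℝ} (ht₀ : 0 < t₀)
    (hint : ∀ t, Integrable (fun x => (p x).eval t) μ)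
    (hc : ∀ t, 0 < t → t < t₀ → ∫ x, (p x).eval t ∂μ = c) :
    ∫ x, (p x).eval 1 ∂μ = c := by
  classical
  set s := Finset.range (d + 1) with hs
  -- `d + 1` distinct interpolation nodes inside `(0, t₀)`. By Lagrange interpolation the value at
  -- `1` is a fixed linear combination of the values at the nodes.
  set v : ℕ → ℝ := fun j => t₀ * ((j + 1) / (d + 2)) with hv
  have hinj : Set.InjOn v s := by
    intro i _ j _ hij
    have h2 : (d : ℝ) + 2 ≠ 0 := by positivity
    have : (i : ℝ) = j := by
      simp only [hv] at hij
      field_simp at hij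
      linarith
    exact_mod_cast this
  have hvpos : ∀ i ∈ s, 0 < v i ∧ v i < t₀ := by
    intro i hi
    have hi' : (i : ℝ) + 1 ≤ d + 1 := by
      have := Finset.mem_range.1 hi
      exact_mod_cast this
    refine ⟨by simp only [hv]; positivity, ?_⟩
    have : ((i : ℝ) + 1) / (d + 2) < 1 := by
      rw [div_lt_one (by positivity)]; linarith
    simp only [hv]
    nlinarith
  have hcard : s.card = d + 1 := by simp [hs]
  have key : ∀ x, (p x).eval 1 = ∑ i ∈ s, (p x).eval (v i) * (Lagrange.basis s v i).eval 1 := by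
    intro x
    have hdeg : (p x).degree < s.card := by
      rw [hcard]
      refine lt_of_le_of_lt Polynomial.degree_le_natDegree ?_
      exact_mod_cast Nat.lt_succ_of_le (hd x)
    have := Lagrange.eq_interpolate hinj hdeg
    conv_lhs => rw [this]
    rw [Lagrange.interpolate_apply, Polynomial.eval_finsetSum]
    simp
  have hone : ∑ i ∈ s, (Lagrange.basis s v i).eval 1 = 1 := by
    rw [← Polynomial.eval_finsetSum, Lagrange.sum_basis hinj ⟨0, by simp [hs]⟩]
    simp
  simp_rw [key]
  rw [integral_finsetSum _ fun i _ => (hint _).mul_const _]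
  simp_rw [integral_mul_const]
  rw [Finset.sum_congr rfl fun i hi => by rw [hc _ (hvpos i hi).1 (hvpos i hi).2],
    ← Finset.mul_sum, hone, mul_one]

/-- A polynomial in `t` evaluating to `det (1 + t A)`. -/
theorem exists_polynomial_det (A : E →L[ℝ] E) :
    ∃ p : Polynomial ℝ, p.natDegree ≤ Module.finrank ℝ E ∧
      ∀ t, p.eval t = (ContinuousLinearMap.id ℝ E + t • A).det := by
  classical
  let b := Module.finBasis ℝ E
  let M := LinearMap.toMatrix b b (A : E →ₗ[ℝ] E)
  refine ⟨((Polynomial.X : Polynomial ℝ) • M.map Polynomial.C + (1 : Matrix (Fin (Module.finrank ℝ E)) (Fin (Module.finrank ℝ E)) ℝ).map Polynomial.C).det, ?_, ?_⟩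
  · simpa using Polynomial.natDegree_det_X_add_C_le M 1
  · intro t
    rw [ContinuousLinearMap.det, ← LinearMap.det_toMatrix b, ← Polynomial.coe_evalRingHom,
      RingHom.map_det]
    congr 1
    ext i j
    have h1 : LinearMap.toMatrix b b ((ContinuousLinearMap.id ℝ E + t • A : E →L[ℝ] E) : E →ₗ[ℝ] E)
        = 1 + t • M := by
      simp [M]
    rw [h1]
    simp [Matrix.one_apply]
    split_ifs <;> simp <;> ring

variable [MeasurableSpace E] [BorelSpace E]

/-- A small perturbation of the identity by a field supported in a ball permutes the ball. -/
theorem exists_integral_perturbation_eq {g : E → E} (hg : ContDiff ℝ 1 g) {ρ : ℝ}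
    (hsupp : ∀ x, ρ < ‖x‖ → g x = 0) :
    ∃ t₀ : ℝ, 0 < t₀ ∧ ∀ t, 0 < t → t < t₀ → ∀ ψ : E → ℝ,
      ∫ x in Metric.closedBall (0 : E) ρ,
        ψ (x + t • g x) * (ContinuousLinearMap.id ℝ E + t • fderiv ℝ g x).det =
      ∫ x in Metric.closedBall (0 : E) ρ, ψ x := by
  have hcomp : HasCompactSupport g := by
    refine HasCompactSupport.of_support_subset_isCompact (isCompact_closedBall (0 : E) ρ) ?_
    intro x hx
    by_contra h
    exact hx (hsupp x (by simpa using h))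
  obtain ⟨K, hK⟩ := hg.lipschitzWith_of_hasCompactSupport hcomp one_ne_zero
  -- The Jacobian determinant stays positive near the identity, so the absolute value in the change
  -- of variables can be dropped.
  have hnear : ∀ᶠ M : E →L[ℝ] E in 𝓝 (ContinuousLinearMap.id ℝ E), 0 < M.det := by
    have h1 : ContinuousLinearMap.det (ContinuousLinearMap.id ℝ E) = 1 := by
      simp [ContinuousLinearMap.det]
    exact (ContinuousLinearMap.continuous_det.tendsto (ContinuousLinearMap.id ℝ E)).eventually
      (lt_mem_nhds (by rw [h1]; exact one_pos))
  obtain ⟨δ, hδ, hball⟩ := Metric.eventually_nhds_iff.1 hnear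
  -- Below this threshold `t * K < 1`, which makes `x + t g(x)` a bijection of `E`, and `t * K < δ`,
  -- which keeps its derivative in the region of positive determinant.
  refine ⟨min 1 δ / (K + 1), by positivity, fun t ht htt ψ => ?_⟩
  have htK : t * (K + 1) < min 1 δ := (lt_div_iff₀ (by positivity)).1 htt
  have htK1 : t * K < 1 := by
    have := min_le_left 1 δ
    nlinarith
  have htKδ : t * K < δ := by
    have := min_le_right 1 δ
    nlinarith
  set f : E → E := fun x => x + t • g x with hf
  have happ : ApproximatesLinearOn f
      ((ContinuousLinearEquiv.refl ℝ E : E ≃L[ℝ] E) : E →L[ℝ] E) Set.univ (t.toNNReal * K) := by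
    rw [ApproximatesLinearOn.approximatesLinearOn_iff_lipschitzOnWith, lipschitzOnWith_univ]
    have : (f - ⇑((ContinuousLinearEquiv.refl ℝ E : E ≃L[ℝ] E) : E →L[ℝ] E)) =
        fun x => t • g x := by
      ext x; simp [hf]
    rw [this]
    refine LipschitzWith.of_dist_le_mul fun x y => ?_
    rw [dist_smul₀, NNReal.coe_mul, Real.coe_toNNReal _ ht.le, Real.norm_of_nonneg ht.le, mul_assoc]
    exact mul_le_mul_of_nonneg_left (hK.dist_le_mul x y) ht.le
  have hcst : Subsingleton E ∨ t.toNNReal * K <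
      ‖((ContinuousLinearEquiv.refl ℝ E).symm : E →L[ℝ] E)‖₊⁻¹ := by
    rcases subsingleton_or_nontrivial E with h | h
    · exact Or.inl h
    · right
      have : ‖((ContinuousLinearEquiv.refl ℝ E).symm : E →L[ℝ] E)‖₊ = 1 := by
        ext
        simp
      rw [this, inv_one, ← NNReal.coe_lt_coe, NNReal.coe_mul, Real.coe_toNNReal _ ht.le]
      exact htK1
  have hinj : Function.Injective f := Set.injOn_univ.1 (happ.injOn hcst)
  have hsurj : Function.Surjective f := happ.surjective hcst
  have hout : ∀ x, x ∉ Metric.closedBall (0 : E) ρ → f x = x := by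
    intro x hx
    simp [hf, hsupp x (by simpa using hx)]
  -- A bijection that fixes every point of the complement of the ball maps the ball onto itself.
  have himage : f '' Metric.closedBall (0 : E) ρ = Metric.closedBall (0 : E) ρ := by
    apply Set.Subset.antisymm
    · rintro _ ⟨x, hx, rfl⟩
      by_contra h
      have := hinj (hout _ h)
      rw [this] at h
      exact h hx
    · intro y hy
      obtain ⟨x, rfl⟩ := hsurj y
      refine ⟨x, ?_, rfl⟩
      by_contra h
      rw [hout x h] at hy
      exact h hy
  have hder : ∀ x, HasFDerivAt f (ContinuousLinearMap.id ℝ E + t • fderiv ℝ g x) x := fun x =>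
    (hasFDerivAt_id x).add (((hg.differentiable one_ne_zero) x).hasFDerivAt.const_smul t)
  have hdet : ∀ x, 0 < (ContinuousLinearMap.id ℝ E + t • fderiv ℝ g x).det := by
    intro x
    apply hball
    rw [dist_eq_norm, add_sub_cancel_left, norm_smul, Real.norm_of_nonneg ht.le]
    exact lt_of_le_of_lt (mul_le_mul_of_nonneg_left (norm_fderiv_le_of_lipschitz ℝ hK) ht.le) htKδ
  have := integral_image_eq_integral_abs_det_fderiv_smul volume
    (measurableSet_closedBall (x := (0 : E)) (ε := ρ))
    (fun x _ => (hder x).hasFDerivWithinAt) hinj.injOn ψ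
  rw [himage] at this
  rw [this]
  congr 1
  ext x
  rw [abs_of_pos (hdet x), smul_eq_mul, mul_comm]

/-- Conservation of weighted volume under `x ↦ x + g x`, for radial polynomial weights. -/
theorem integral_pow_mul_det_eq {g : E → E} (hg : ContDiff ℝ 1 g) {ρ : ℝ}
    (hsupp : ∀ x, ρ < ‖x‖ → g x = 0) (m : ℝ) (k : ℕ) :
    ∫ x in Metric.closedBall (0 : E) ρ, (1 - m * ‖x + g x‖ ^ 2) ^ k *
        (ContinuousLinearMap.id ℝ E + fderiv ℝ g x).det =
      ∫ x in Metric.closedBall (0 : E) ρ, (1 - m * ‖x‖ ^ 2) ^ k := by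
  obtain ⟨t₀, ht₀, H⟩ := exists_integral_perturbation_eq hg hsupp
  choose p hpd hpe using fun x => exists_polynomial_det (fderiv ℝ g x)
  -- The integrand is polynomial in `t`. Its integral is constant for small `t`, where the map is a
  -- bijection, hence also at `t = 1`, where it need not be one.
  let q : E → Polynomial ℝ := fun x =>
    (Polynomial.C (1 - m * ‖x‖ ^ 2) + Polynomial.C (-(2 * m * inner ℝ x (g x))) * Polynomial.X
      + Polynomial.C (-(m * ‖g x‖ ^ 2)) * Polynomial.X ^ 2) ^ k * p x
  have hq : ∀ x t, (q x).eval t = (1 - m * ‖x + t • g x‖ ^ 2) ^ k *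
      (ContinuousLinearMap.id ℝ E + t • fderiv ℝ g x).det := by
    intro x t
    simp only [q, Polynomial.eval_mul, Polynomial.eval_pow, Polynomial.eval_add,
      Polynomial.eval_C, Polynomial.eval_X, hpe]
    congr 2
    rw [norm_add_sq_real, inner_smul_right, norm_smul, mul_pow, Real.norm_eq_abs, sq_abs]
    ring
  have hqd : ∀ x, (q x).natDegree ≤ k * 2 + Module.finrank ℝ E := by
    intro x
    refine Polynomial.natDegree_mul_le.trans (add_le_add ?_ (hpd x))
    refine Polynomial.natDegree_pow_le_of_le k ?_
    compute_degree
  have hgc : Continuous g := hg.continuous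
  have hg' : Continuous (fderiv ℝ g) := hg.continuous_fderiv one_ne_zero
  have := integral_eval_one_eq_of_small (μ := volume.restrict (Metric.closedBall (0 : E) ρ)) q _ hqd
    ht₀ (c := ∫ x in Metric.closedBall (0 : E) ρ, (1 - m * ‖x‖ ^ 2) ^ k) ?_ ?_
  · simpa [hq] using this
  · intro t
    simp_rw [hq]
    refine ContinuousOn.integrableOn_compact (isCompact_closedBall _ _) (Continuous.continuousOn ?_)
    refine Continuous.mul (by fun_prop) (ContinuousLinearMap.continuous_det.comp (by fun_prop))
  · intro t h1 h2
    simp_rw [hq]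
    exact H t h1 h2 fun y => (1 - m * ‖y‖ ^ 2) ^ k

/-- The identity perturbed by a compactly supported `C¹` field has a zero. -/
theorem exists_add_eq_zero {g : E → E} (hg : ContDiff ℝ 1 g) {ρ : ℝ} (hρ : 0 < ρ)
    (hsupp : ∀ x, ρ < ‖x‖ → g x = 0) : ∃ x, x + g x = 0 := by
  by_contra! hne
  have hgc : Continuous g := hg.continuous
  have hg' : Continuous (fderiv ℝ g) := hg.continuous_fderiv one_ne_zero
  set B := Metric.closedBall (0 : E) ρ with hB
  have hBc : IsCompact B := isCompact_closedBall _ _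
  have hBne : B.Nonempty := ⟨0, by simp [hB, hρ.le]⟩
  obtain ⟨x₀, -, hx₀⟩ := hBc.exists_isMinOn hBne
    (f := fun x => ‖x + g x‖) (by fun_prop : Continuous fun x => ‖x + g x‖).continuousOn
  set δ := ‖x₀ + g x₀‖ with hδ
  have hδpos : 0 < δ := norm_pos_iff.2 (hne x₀)
  obtain ⟨M₀, hM₀⟩ := hBc.exists_bound_of_continuousOn
    (f := fun x => x + g x) (by fun_prop : Continuous fun x => x + g x).continuousOn
  obtain ⟨D, hD⟩ := hBc.exists_bound_of_continuousOn
    (f := fun x => (ContinuousLinearMap.id ℝ E + fderiv ℝ g x).det)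
    (ContinuousLinearMap.continuous_det.comp (by fun_prop)).continuousOn
  set M := max M₀ ρ with hM
  have hMpos : 0 < M := lt_of_lt_of_le hρ (le_max_right _ _)
  set r := min (δ / 2) ρ with hr
  have hrpos : 0 < r := by positivity
  have hrδ : r < δ := lt_of_le_of_lt (min_le_left _ _) (by linarith)
  have hδM : δ ≤ M := by
    have := hM₀ 0 (by simp [hB, hρ.le])
    have h2 : δ ≤ ‖(0 : E) + g 0‖ := hx₀ (by simp [hB, hρ.le])
    exact h2.trans (this.trans (le_max_left _ _))
  -- The weight `1 - m|y|²` is nonnegative for `|y| ≤ M` and decreases in `|y|`. Without a zero, `|x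
  -- + g x| ≥ δ` on the ball, so the transported weight is at most `q₁`, whereas the original weight
  -- is at least `q₂ > q₁` on the ball of radius `r < δ`. Equality of the `k`-th power integrals
  -- fails for large `k`.
  set m := 1 / M ^ 2 with hm
  have hmpos : 0 < m := by positivity
  have hmM : ∀ s, 0 ≤ s → s ≤ M → 0 ≤ 1 - m * s ^ 2 := by
    intro s hs hsM
    have : s ^ 2 ≤ M ^ 2 := by gcongr
    rw [hm, one_div_mul_eq_div, sub_nonneg, div_le_one (by positivity)]
    exact this
  set q₁ := 1 - m * δ ^ 2 with hq₁
  set q₂ := 1 - m * r ^ 2 with hq₂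
  have hq₁0 : 0 ≤ q₁ := hmM δ hδpos.le hδM
  have hq12 : q₁ < q₂ := by
    have : r ^ 2 < δ ^ 2 := by gcongr
    simp only [hq₁, hq₂]
    nlinarith
  have hq₂0 : 0 < q₂ := lt_of_le_of_lt hq₁0 hq12
  have hVr : 0 < volume.real (Metric.closedBall (0 : E) r) :=
    ENNReal.toReal_pos (Metric.measure_closedBall_pos volume _ hrpos).ne' measure_closedBall_lt_top.ne
  have upper : ∀ k : ℕ, ∫ x in B, (1 - m * ‖x + g x‖ ^ 2) ^ k *
      (ContinuousLinearMap.id ℝ E + fderiv ℝ g x).det ≤ q₁ ^ k * D * volume.real B := by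
    intro k
    refine (le_abs_self _).trans ?_
    rw [← Real.norm_eq_abs]
    refine norm_setIntegral_le_of_norm_le_const hBc.measure_lt_top fun x hx => ?_
    have h0 := hmM _ (norm_nonneg _) ((hM₀ x hx).trans (le_max_left _ _))
    rw [norm_mul, norm_pow, Real.norm_of_nonneg h0]
    have h1 : (1 - m * ‖x + g x‖ ^ 2) ≤ q₁ := by
      have : δ ≤ ‖x + g x‖ := hx₀ hx
      have : δ ^ 2 ≤ ‖x + g x‖ ^ 2 := by gcongr
      simp only [hq₁]
      nlinarith
    exact mul_le_mul (pow_le_pow_left₀ h0 h1 k) (hD x hx) (norm_nonneg _) (by positivity)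
  have lower : ∀ k : ℕ, q₂ ^ k * volume.real (Metric.closedBall (0 : E) r) ≤
      ∫ x in B, (1 - m * ‖x‖ ^ 2) ^ k := by
    intro k
    have hsub : Metric.closedBall (0 : E) r ⊆ B := Metric.closedBall_subset_closedBall (min_le_right _ _)
    have hint : IntegrableOn (fun x : E => (1 - m * ‖x‖ ^ 2) ^ k) B :=
      ContinuousOn.integrableOn_compact hBc
        (by fun_prop : Continuous fun x : E => (1 - m * ‖x‖ ^ 2) ^ k).continuousOn
    have hle : ∫ x in Metric.closedBall (0 : E) r, (1 - m * ‖x‖ ^ 2) ^ k ≤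
        ∫ x in B, (1 - m * ‖x‖ ^ 2) ^ k := by
      refine setIntegral_mono_set hint ?_ hsub.eventuallyLE
      refine (ae_restrict_mem hBc.measurableSet).mono fun x hx => ?_
      have : ‖x‖ ≤ M := (by simpa [hB] using hx : ‖x‖ ≤ ρ).trans (le_max_right _ _)
      exact pow_nonneg (hmM _ (norm_nonneg _) this) k
    refine le_trans ?_ hle
    have : ∫ x in Metric.closedBall (0 : E) r, q₂ ^ k =
        q₂ ^ k * volume.real (Metric.closedBall (0 : E) r) := by
      rw [setIntegral_const, smul_eq_mul, mul_comm]
    rw [← this]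
    refine setIntegral_mono_on (integrableOn_const measure_closedBall_lt_top.ne) (hint.mono_set hsub)
      measurableSet_closedBall fun x hx => ?_
    have hx' : ‖x‖ ≤ r := by simpa using hx
    have : ‖x‖ ^ 2 ≤ r ^ 2 := by gcongr
    refine pow_le_pow_left₀ hq₂0.le ?_ k
    simp only [hq₂]
    nlinarith
  have hall : ∀ k : ℕ, volume.real (Metric.closedBall (0 : E) r) ≤
      (q₁ / q₂) ^ k * (D * volume.real B) := by
    intro k
    have h := (lower k).trans ((integral_pow_mul_det_eq hg hsupp m k).symm.le.trans (upper k))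
    rw [div_pow, div_mul_eq_mul_div, le_div_iff₀ (by positivity)]
    linarith
  have hlim : Tendsto (fun k : ℕ => (q₁ / q₂) ^ k * (D * volume.real B)) atTop (𝓝 (0 * _)) :=
    (tendsto_pow_atTop_nhds_zero_of_lt_one (by positivity) ((div_lt_one hq₂0).2 hq12)).mul_const _
  rw [zero_mul] at hlim
  exact absurd (ge_of_tendsto' hlim hall) (not_le.2 hVr)

end Degree

/-- A `C¹` vector field pointing outwards far from the origin has a zero. -/
theorem exists_zero_of_inner_pos {E : Type*} [NormedAddCommGroup E] [InnerProductSpace ℝ E]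
    [FiniteDimensional ℝ E] {F : E → E} (hF : ContDiff ℝ 1 F) {R : ℝ} (hR : 0 < R)
    (hpos : ∀ x, R ≤ ‖x‖ → 0 < inner ℝ (F x) x) : ∃ x, F x = 0 := by
  borelize E
  -- The field `x + χ(x)(F x - x)` equals `F` for `|x| ≤ R`. Further out it is a convex combination
  -- of `x` and `F x`, both of which have positive inner product with `x`, so it has no zero there.
  let χ : ContDiffBump (0 : E) := ⟨R, R + 1, hR, by linarith⟩
  obtain ⟨x, hx⟩ := exists_add_eq_zero (g := fun x => χ x • (F x - x))
    ((χ.contDiff (n := 1)).smul (hF.sub contDiff_id)) (ρ := R + 1) (by linarith) (fun x hx => by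
      have : χ x = 0 := χ.zero_of_le_dist (by simpa [χ] using hx.le)
      simp [this])
  refine ⟨x, ?_⟩
  rcases le_or_gt ‖x‖ R with h | h
  · have : χ x = 1 := χ.one_of_mem_closedBall (by simpa [χ] using h)
    simpa [this] using hx
  · exfalso
    have h1 : inner ℝ (x + χ x • (F x - x)) x = 0 := by rw [hx, inner_zero_left]
    rw [inner_add_left, inner_smul_left, inner_sub_left, real_inner_self_eq_norm_sq] at h1
    simp only [conj_trivial] at h1
    have h2 := hpos x h.le
    have h3 : 0 ≤ χ x := χ.nonneg
    have h4 : χ x ≤ 1 := χ.le_one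
    have h5 : 0 < ‖x‖ ^ 2 := by have := hR.trans h; positivity
    rcases eq_or_lt_of_le h4 with h6 | h6
    · rw [h6] at h1; linarith
    · nlinarith [mul_nonneg h3 h2.le, mul_pos (sub_pos.2 h6) h5]

/-! ### Galerkin approximation in an abstract Hilbert space -/

theorem contDiff_bilin_diag {V : Type*} [NormedAddCommGroup V] [NormedSpace ℝ V]
    [FiniteDimensional ℝ V] (B : V →ₗ[ℝ] V →ₗ[ℝ] ℝ) {n : WithTop ℕ∞} :
    ContDiff ℝ n fun x => B x x := by
  let B' : V →L[ℝ] V →L[ℝ] ℝ := LinearMap.toContinuousLinearMap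
    ((LinearMap.toContinuousLinearMap (𝕜 := ℝ) (E := V) (F' := ℝ)).toLinearMap ∘ₗ B)
  have : (fun x => B x x) = fun x => B' x x := rfl
  rw [this]
  exact B'.contDiff.clm_apply contDiff_id

section Galerkin

variable {C K : Type*} [AddCommGroup C] [Module ℝ C] [NormedAddCommGroup K]
  [InnerProductSpace ℝ K]

/-- Solvability of the Galerkin equations on a finite-dimensional subspace. -/
theorem exists_galerkin_solution (e : C →ₗ[ℝ] K) (he : Function.Injective e) (l : C →ₗ[ℝ] ℝ)
    {M : ℝ} (hl : ∀ φ, |l φ| ≤ M * ‖e φ‖) (N : C →ₗ[ℝ] C →ₗ[ℝ] C →ₗ[ℝ] ℝ)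
    (hN : ∀ u, N u u u = 0) (W : Submodule ℝ C) [FiniteDimensional ℝ W] :
    ∃ u ∈ W, ∀ φ ∈ W, inner ℝ (e u) (e φ) = l φ + N u u φ := by
  let W' := W.map e
  let i : W' →ₗ[ℝ] C := W.subtype ∘ₗ (W.equivMapOfInjective e he).symm.toLinearMap
  have hei : ∀ x : W', e (i x) = x := fun x => by
    have := W.coe_equivMapOfInjective_apply e he ((W.equivMapOfInjective e he).symm x)
    rw [LinearEquiv.apply_symm_apply] at this
    exact this.symm
  have hie : ∀ φ (h : φ ∈ W), i ⟨e φ, Submodule.mem_map_of_mem h⟩ = φ := fun φ h =>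
    he (hei _)
  let b := stdOrthonormalBasis ℝ W'
  let r : W' → (W' →ₗ[ℝ] ℝ) := fun x => l ∘ₗ i + (N (i x) (i x)) ∘ₗ i
  -- The Riesz representative of the residual of the Galerkin equation. Its zeros are the solutions.
  let F : W' → W' := fun x => x - ∑ k, r x (b k) • b k
  have hF : ∀ x y, inner ℝ (F x) y = inner ℝ x y - r x y := by
    intro x y
    have h1 : r x y = ∑ k, inner ℝ (b k) y * r x (b k) := by
      conv_lhs => rw [← b.sum_repr' y]
      simp
    simp only [F]
    rw [inner_sub_left, sum_inner, h1]
    congr 1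
    refine Finset.sum_congr rfl fun k _ => ?_
    rw [inner_smul_left, mul_comm]
    simp
  have hFc : ContDiff ℝ 1 F := by
    refine contDiff_id.sub (ContDiff.sum fun k _ => ?_)
    refine ContDiff.smul (f := fun x => r x (b k)) (g := fun _ => b k) ?_ contDiff_const
    refine contDiff_const.add ?_
    exact contDiff_bilin_diag
      (LinearMap.compl₁₂ (N.compr₂ (LinearMap.applyₗ (i (b k)))) i i)
  -- As the cubic term drops out, `⟪F x, x⟫ = ‖x‖² - l x ≥ ‖x‖ (‖x‖ - M)`, which is positive once
  -- `‖x‖ ≥ |M| + 1`.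
  obtain ⟨x, hx⟩ := exists_zero_of_inner_pos hFc (R := |M| + 1) (by positivity) (by
    intro x hx
    rw [hF, real_inner_self_eq_norm_sq]
    have h1 : r x x = l (i x) := by simp [r, hN]
    have h2 := hl (i x)
    rw [hei] at h2
    have h3 : ‖(x : K)‖ = ‖x‖ := rfl
    have h4 := le_abs_self (l (i x))
    have h5 := le_abs_self M
    have h6 := abs_nonneg M
    rw [h1]
    rw [h3] at h2
    nlinarith)
  refine ⟨i x, by simp [i], fun φ hφ => ?_⟩
  have := hF x ⟨e φ, Submodule.mem_map_of_mem hφ⟩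
  rw [hx, inner_zero_left] at this
  simp only [r, LinearMap.add_apply, LinearMap.comp_apply, hie φ hφ] at this
  rw [hei, ← sub_eq_zero]
  exact this.symm

/-- Bounded families in a Hilbert space converge weakly along ultrafilters. -/
theorem exists_weak_limit [CompleteSpace K] {I : Type*} (U : Ultrafilter I) (x : I → K) {M : ℝ}
    (hx : ∀ i, ‖x i‖ ≤ M) :
    ∃ g : K, ∀ Λ : K →L[ℝ] ℝ, Tendsto (fun i => Λ (x i)) U (𝓝 (Λ g)) := by
  let y : I → WeakDual ℝ K := fun i =>
    StrongDual.toWeakDual (InnerProductSpace.toDual ℝ K (x i))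
  have hy : ∀ i, y i ∈ WeakDual.toStrongDual ⁻¹' Metric.closedBall (0 : StrongDual ℝ K) M := by
    intro i
    simp [y, hx i]
  -- Banach–Alaoglu for the dual ball, after the Riesz identification.
  obtain ⟨d, -, hd⟩ := (WeakDual.isCompact_closedBall (𝕜 := ℝ) (0 : StrongDual ℝ K) M).ultrafilter_le_nhds
    (U.map y) (le_principal_iff.2 (Filter.mem_map.2 (Filter.univ_mem' hy)))
  refine ⟨(InnerProductSpace.toDual ℝ K).symm (WeakDual.toStrongDual d), fun Λ => ?_⟩
  have h1 : Tendsto y U (𝓝 d) := hd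
  have h2 := ((WeakDual.eval_continuous ((InnerProductSpace.toDual ℝ K).symm Λ)).tendsto d).comp h1
  have h3 : ∀ z, Λ z = inner ℝ z ((InnerProductSpace.toDual ℝ K).symm Λ) := fun z => by
    rw [real_inner_comm, InnerProductSpace.toDual_symm_apply]
  simp_rw [h3]
  rw [InnerProductSpace.toDual_symm_apply]
  exact h2

/-- Galerkin approximations along an ultrafilter, together with their weak limit. -/
theorem exists_galerkin_limit [CompleteSpace K] (e : C →ₗ[ℝ] K) (he : Function.Injective e)
    (l : C →ₗ[ℝ] ℝ) {M : ℝ} (hM : 0 ≤ M) (hl : ∀ φ, |l φ| ≤ M * ‖e φ‖)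
    (N : C →ₗ[ℝ] C →ₗ[ℝ] C →ₗ[ℝ] ℝ) (hN : ∀ u, N u u u = 0) :
    ∃ (U : Ultrafilter (Finset C)) (u : Finset C → C) (g : K),
      (∀ S, ‖e (u S)‖ ^ 2 = l (u S)) ∧ (∀ S, ‖e (u S)‖ ≤ M) ∧
      (∀ φ, ∀ᶠ S in U, inner ℝ (e (u S)) (e φ) = l φ + N (u S) (u S) φ) ∧
      ∀ Λ : K →L[ℝ] ℝ, Tendsto (fun S => Λ (e (u S))) U (𝓝 (Λ g)) := by
  choose u hu hsol using fun S : Finset C =>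
    exists_galerkin_solution e he l hl N hN (Submodule.span ℝ (S : Set C))
  have hen : ∀ S, ‖e (u S)‖ ^ 2 = l (u S) := fun S => by
    rw [← real_inner_self_eq_norm_sq, hsol S _ (hu S), hN, add_zero]
  have hbd : ∀ S, ‖e (u S)‖ ≤ M := fun S => by
    have h1 := (le_abs_self _).trans (hl (u S))
    rw [← hen, sq] at h1
    by_contra! h
    have h0 := norm_nonneg (e (u S))
    rcases h0.eq_or_lt with h2 | h2
    · linarith
    · nlinarith
  obtain ⟨g, hg⟩ := exists_weak_limit (Ultrafilter.of atTop) (fun S => e (u S)) hbd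
  refine ⟨Ultrafilter.of atTop, u, g, hen, hbd, fun φ => ?_, hg⟩
  -- For a fixed `φ`, the finite sets containing `φ` form a tail of `atTop`, and the Galerkin
  -- equation on their span may be tested with `φ`.
  refine (Ultrafilter.of_le atTop) ?_
  filter_upwards [eventually_ge_atTop {φ}] with S hS
  exact hsol S φ (Submodule.subset_span (hS (Finset.mem_singleton_self φ)))

end Galerkin

/-! ### The space of test fields -/

theorem rigid_add (a b a' b' x : E3) : rigid (a + a') (b + b') x = rigid a b x + rigid a' b' x := by
  simp only [rigid, WithLp.ofLp_add, map_add, LinearMap.add_apply, WithLp.toLp_add]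
  abel

theorem rigid_smul (c : ℝ) (a b x : E3) : rigid (c • a) (c • b) x = c • rigid a b x := by
  simp only [rigid, WithLp.ofLp_smul, map_smul, LinearMap.smul_apply, WithLp.toLp_smul, smul_add]

theorem rigid_zero (x : E3) : rigid 0 0 x = 0 := by
  simpa using rigid_smul 0 0 0 x

theorem continuous_rigid (a b : E3) : Continuous (rigid a b) := by
  unfold rigid
  refine continuous_const.add ((PiLp.continuous_toLp 2 _).comp ?_)
  exact (LinearMap.continuous_of_finiteDimensional (crossProduct b.ofLp)).comp
    (PiLp.continuous_ofLp 2 _)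

theorem grad_add {φ ψ : E3 → E3} (hφ : Differentiable ℝ φ) (hψ : Differentiable ℝ ψ) (x : E3) :
    grad (φ + ψ) x = grad φ x + grad ψ x := by
  ext i j
  simp [grad, fderiv_add (hφ x) (hψ x)]

theorem grad_const_smul {φ : E3 → E3} (c : ℝ) (x : E3) :
    grad (c • φ) x = c • grad φ x := by
  ext i j
  simp [grad, fderiv_const_smul_field]

theorem grad_zero (x : E3) : grad (0 : E3 → E3) x = 0 := by
  ext i j
  simp [grad]

theorem IsTestField.differentiable {φ : E3 → E3} {a b : E3} (h : IsTestField φ a b) :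
    Differentiable ℝ φ := h.smooth.differentiable (by simp)

/-- The test fields, recorded together with their characteristic vectors. -/
def testSpace : Submodule ℝ ((E3 → E3) × E3 × E3) where
  carrier := {p | IsTestField p.1 p.2.1 p.2.2}
  zero_mem' :=
    { smooth := contDiff_const
      compact := HasCompactSupport.zero
      rigid_near := Eventually.of_forall fun x => (rigid_zero x).symm
      div_free := fun x => by simp [grad_zero] }
  add_mem' := fun {p q} hp hq =>
    { smooth := hp.smooth.add hq.smooth
      compact := hp.compact.add hq.compact
      rigid_near := by
        filter_upwards [hp.rigid_near, hq.rigid_near] with x h1 h2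
        simp [h1, h2, rigid_add]
      div_free := fun x => by
        simp [grad_add hp.differentiable hq.differentiable, hp.div_free, hq.div_free] }
  smul_mem' := fun c p hp =>
    { smooth := contDiff_const.smul hp.smooth
      compact := hp.compact.smul_left
      rigid_near := by
        filter_upwards [hp.rigid_near] with x h1
        simp [h1, rigid_smul]
      div_free := fun x => by
        simp [grad_const_smul, hp.div_free] }

/-- Test fields with their characteristic vectors. -/
abbrev TestField : Type := testSpace

namespace TestField

variable (u : TestField)

/-- The underlying vector field. -/
def field : E3 → E3 := u.1.1

/-- The translational velocity. -/
def trans : E3 := u.1.2.1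

/-- The angular velocity. -/
def ang : E3 := u.1.2.2

theorem isTestField : IsTestField u.field u.trans u.ang := u.2

theorem differentiable : Differentiable ℝ u.field := u.isTestField.differentiable

theorem contDiff_fderiv_apply (j : Fin 3) : ContDiff ℝ ∞ fun x => fderiv ℝ u.field x (e j) :=
  (u.isTestField.smooth.fderiv_right (m := ∞) (by simp)).clm_apply contDiff_const

theorem contDiff_field (i : Fin 3) : ContDiff ℝ ∞ fun x => u.field x i :=
  (EuclideanSpace.proj (𝕜 := ℝ) i).contDiff.comp u.isTestField.smooth

theorem hasCompactSupport_field (i : Fin 3) : HasCompactSupport fun x => u.field x i :=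
  u.isTestField.compact.comp_left (g := fun y : E3 => y i) rfl

theorem grad_eq_fderiv (i j : Fin 3) (x : E3) :
    grad u.field x i j = fderiv ℝ (fun y => u.field y i) x (e j) := by
  have : HasFDerivAt (fun y => u.field y i)
      ((EuclideanSpace.proj (𝕜 := ℝ) i : E3 →L[ℝ] ℝ) ∘L fderiv ℝ u.field x) x :=
    (EuclideanSpace.proj (𝕜 := ℝ) i : E3 →L[ℝ] ℝ).hasFDerivAt.comp x
      (u.differentiable x).hasFDerivAt
  rw [this.fderiv]
  rfl

theorem contDiff_grad (i j : Fin 3) : ContDiff ℝ ∞ fun x => grad u.field x i j :=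
  (EuclideanSpace.proj (𝕜 := ℝ) i).contDiff.comp (u.contDiff_fderiv_apply j)

theorem hasCompactSupport_grad (i j : Fin 3) : HasCompactSupport fun x => grad u.field x i j := by
  have := (u.isTestField.compact.fderiv_apply (𝕜 := ℝ) (e j)).comp_left
    (g := fun y : E3 => y i) rfl
  exact this

theorem memLp_field (p : ENNReal) : MemLp u.field p volume :=
  u.isTestField.smooth.continuous.memLp_of_hasCompactSupport u.isTestField.compact

theorem memLp_grad (i j : Fin 3) (p : ENNReal) : MemLp (fun x => grad u.field x i j) p volume :=
  (u.contDiff_grad i j).continuous.memLp_of_hasCompactSupport (u.hasCompactSupport_grad i j)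

end TestField

/-- Square-integrable matrix fields. -/
abbrev MatL2 := PiLp 2 fun _ : Fin 3 × Fin 3 => Lp ℝ 2 (volume : Measure E3)

/-- The gradient of a test field as a square-integrable matrix field. -/
def gradL2 : TestField →ₗ[ℝ] MatL2 where
  toFun u := WithLp.toLp 2 fun p => (u.memLp_grad p.1 p.2 2).toLp _
  map_add' u v := by
    ext1 p
    simp only [PiLp.add_apply]
    rw [← MemLp.toLp_add]
    congr 1
    ext x
    exact congrFun (congrFun (grad_add u.differentiable v.differentiable x) p.1) p.2
  map_smul' c u := by
    ext1 p
    simp only [PiLp.smul_apply, RingHom.id_apply]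
    rw [← MemLp.toLp_const_smul]
    congr 1
    ext x
    exact congrFun (congrFun (grad_const_smul c x) p.1) p.2

theorem gradL2_apply (u : TestField) (p : Fin 3 × Fin 3) :
    gradL2 u p = (u.memLp_grad p.1 p.2 2).toLp _ := rfl

theorem coeFn_gradL2 (u : TestField) (i j : Fin 3) :
    gradL2 u (i, j) =ᵐ[volume] fun x => grad u.field x i j :=
  MemLp.coeFn_toLp (u.memLp_grad i j 2)

/-- The closure of the gradients of test fields. -/
abbrev GradSpace : Submodule ℝ MatL2 := (LinearMap.range gradL2).topologicalClosure

instance : CompleteSpace GradSpace :=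
  (Submodule.isClosed_topologicalClosure _).completeSpace_coe

/-- The gradient of a test field as an element of `GradSpace`. -/
def gradK : TestField →ₗ[ℝ] GradSpace :=
  gradL2.codRestrict GradSpace fun u =>
    Submodule.le_topologicalClosure _ (LinearMap.mem_range_self gradL2 u)

theorem coe_gradK (u : TestField) : (gradK u : MatL2) = gradL2 u := rfl

/-- Continuous identities and closed inequalities on `GradSpace` thus need checking only on test
fields. -/
theorem denseRange_gradK : DenseRange gradK := by
  intro g
  have hg : (g : MatL2) ∈ closure (Set.range gradL2) := by
    exact g.2
  obtain ⟨x, hx, hlim⟩ := mem_closure_iff_seq_limit.1 hg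
  choose u hu using hx
  refine mem_closure_iff_seq_limit.2 ⟨fun n => gradK (u n), fun n => ⟨u n, rfl⟩, ?_⟩
  rw [tendsto_subtype_rng]
  simpa [coe_gradK, hu] using hlim

/-- The `L²` norm of a component is bounded by the norm. -/
theorem eLpNorm_grad_le (u : TestField) (i j : Fin 3) :
    eLpNorm (fun x => grad u.field x i j) 2 volume ≤ ENNReal.ofReal ‖gradK u‖ := by
  have h1 : ‖gradL2 u (i, j)‖ ≤ ‖gradL2 u‖ := PiLp.norm_apply_le _ _
  rw [gradL2_apply, Lp.norm_toLp] at h1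
  exact (ENNReal.le_ofReal_iff_toReal_le (u.memLp_grad i j 2).2.ne (norm_nonneg _)).2 h1

/-! ### Sobolev embedding of the gradient space -/

theorem norm_le_sum_abs (y : E3) : ‖y‖ ≤ ∑ i, |y i| := by
  have : y = ∑ j, y j • e j := by
    simpa [e] using ((EuclideanSpace.basisFun (Fin 3) ℝ).sum_repr y).symm
  conv_lhs => rw [this]
  refine (norm_sum_le _ _).trans (Finset.sum_le_sum fun i _ => ?_)
  simp [norm_smul, e]

theorem norm_fderiv_le_sum (u : TestField) (x : E3) :
    ‖fderiv ℝ u.field x‖ ≤ ∑ p : Fin 3 × Fin 3, |grad u.field x p.1 p.2| := by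
  refine ContinuousLinearMap.opNorm_le_bound _ (Finset.sum_nonneg fun _ _ => abs_nonneg _) fun h => ?_
  have h1 : h = ∑ j, h j • e j := by
    simpa [e] using ((EuclideanSpace.basisFun (Fin 3) ℝ).sum_repr h).symm
  calc ‖fderiv ℝ u.field x h‖ = ‖∑ j, h j • fderiv ℝ u.field x (e j)‖ := by
        conv_lhs => rw [h1]
        simp
    _ ≤ ∑ j, ‖h j • fderiv ℝ u.field x (e j)‖ := norm_sum_le _ _
    _ ≤ ∑ j, ‖h‖ * ∑ i, |grad u.field x i j| := by
        refine Finset.sum_le_sum fun j _ => ?_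
        rw [norm_smul]
        exact mul_le_mul (PiLp.norm_apply_le h j) (norm_le_sum_abs _) (norm_nonneg _) (norm_nonneg _)
    _ = _ := by
        rw [← Finset.mul_sum, mul_comm, Fintype.sum_prod_type, Finset.sum_comm]

theorem eLpNorm_fderiv_le (u : TestField) :
    eLpNorm (fderiv ℝ u.field) 2 volume ≤ ENNReal.ofReal (9 * ‖gradK u‖) := by
  calc eLpNorm (fderiv ℝ u.field) 2 volume
      ≤ eLpNorm (fun x => ∑ p : Fin 3 × Fin 3, |grad u.field x p.1 p.2|) 2 volume :=
        eLpNorm_mono_real (norm_fderiv_le_sum u)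
    _ = eLpNorm (∑ p : Fin 3 × Fin 3, fun x => |grad u.field x p.1 p.2|) 2 volume := by
        congr 1
    _ ≤ ∑ p : Fin 3 × Fin 3, eLpNorm (fun x => |grad u.field x p.1 p.2|) 2 volume :=
        eLpNorm_sum_le (fun p _ => (u.memLp_grad p.1 p.2 2).1.norm) (by norm_num)
    _ ≤ ∑ p : Fin 3 × Fin 3, ENNReal.ofReal ‖gradK u‖ := by
        refine Finset.sum_le_sum fun p _ => ?_
        refine (eLpNorm_norm (fun x => grad u.field x p.1 p.2)).le.trans (eLpNorm_grad_le u p.1 p.2)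
    _ = _ := by
        rw [ENNReal.ofReal_mul (by norm_num)]
        simp

instance : Fact ((1 : ENNReal) ≤ 6) := ⟨by norm_num⟩

/-- A test field as an element of `L⁶`. -/
def toL6 : TestField →ₗ[ℝ] Lp E3 6 (volume : Measure E3) where
  toFun u := (u.memLp_field 6).toLp _
  map_add' _ _ := MemLp.toLp_add _ _
  map_smul' _ _ := MemLp.toLp_const_smul _ _

/-- The Gagliardo–Nirenberg–Sobolev inequality with `1/6 = 1/2 - 1/3`. The factor `9` counts the
entries of the gradient matrix. -/
theorem exists_norm_toL6_le : ∃ c : ℝ, ∀ u, ‖toL6 u‖ ≤ c * ‖gradK u‖ := by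
  refine ⟨SNormLESNormFDerivOfEqConst E3 (volume : Measure E3) 2 * 9, fun u => ?_⟩
  have h := eLpNorm_le_eLpNorm_fderiv_of_eq (μ := (volume : Measure E3)) (F := E3)
    (u.isTestField.smooth.of_le (by exact_mod_cast le_top)) u.isTestField.compact (p := 2) (p' := 6)
    (by norm_num) (by simp) (by simp; norm_num)
  have h2 := h.trans (mul_le_mul_right (eLpNorm_fderiv_le u) _)
  change ‖(u.memLp_field 6).toLp _‖ ≤ _
  rw [Lp.norm_toLp]
  refine ENNReal.toReal_le_of_le_ofReal (by positivity) (h2.trans_eq ?_)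
  rw [mul_assoc, ENNReal.ofReal_mul NNReal.zero_le_coe, ENNReal.ofReal_coe_nnreal]
  simp

/-- The realization of `GradSpace` as a space of fields in `L⁶`. -/
def velocity : GradSpace →L[ℝ] Lp E3 6 (volume : Measure E3) := toL6.extendOfNorm gradK

theorem velocity_gradK (u : TestField) : velocity (gradK u) = toL6 u :=
  LinearMap.extendOfNorm_eq denseRange_gradK exists_norm_toL6_le u

/-! ### Rigid velocity fields -/

instance : IsFiniteMeasure ((volume : Measure E3).restrict body) :=
  ⟨by simp [body]⟩

theorem memLp_rigid (a b : E3) : MemLp (rigid a b) 6 (volume.restrict body) := by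
  obtain ⟨c, hc⟩ := (isCompact_closedBall (0 : E3) 1).exists_bound_of_continuousOn
    (continuous_rigid a b).continuousOn
  exact MemLp.of_bound (continuous_rigid a b).aestronglyMeasurable c
    ((ae_restrict_mem measurableSet_closedBall).mono hc)

/-- Rigid fields on the body, as elements of `L⁶`. -/
def rigidL6 : E3 × E3 →ₗ[ℝ] Lp E3 6 ((volume : Measure E3).restrict body) where
  toFun p := (memLp_rigid p.1 p.2).toLp _
  map_add' p q := by
    rw [← MemLp.toLp_add]
    congr 1
    ext1 x
    exact rigid_add _ _ _ _ x
  map_smul' c p := by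
    rw [RingHom.id_apply, ← MemLp.toLp_const_smul]
    congr 1
    ext1 x
    exact rigid_smul _ _ _ x

/-- The value at the origin gives `a`, and the values at `e j / 2` give `b × e j`. -/
theorem eq_zero_of_rigid_eq_zero {a b : E3} (h : ∀ x ∈ Metric.ball (0 : E3) 1, rigid a b x = 0) :
    a = 0 ∧ b = 0 := by
  have ha : a = 0 := by
    have := h 0 (by simp)
    simpa [rigid] using this
  subst ha
  have hc : ∀ j : Fin 3, crossProduct b.ofLp (e j).ofLp = 0 := by
    intro j
    have := h ((1 / 2 : ℝ) • e j) (by simp [e, norm_smul]; norm_num)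
    simpa [rigid] using this
  refine ⟨rfl, ?_⟩
  have h0 := hc 0
  have h1 := hc 1
  simp [e, cross_apply] at h0 h1
  ext i
  fin_cases i
  · simpa using h1.2
  · simpa using h0.2
  · simpa using h0.1

theorem rigidL6_injective : Function.Injective rigidL6 := by
  rw [← LinearMap.ker_eq_bot, LinearMap.ker_eq_bot']
  rintro ⟨a, b⟩ h
  have h1 : rigid a b =ᵐ[volume.restrict body] 0 :=
    (memLp_rigid a b).coeFn_toLp.symm.trans (by
      have : (memLp_rigid a b).toLp _ = 0 := h
      rw [this]; exact Lp.coeFn_zero _ _ _)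
  have h2 : rigid a b =ᵐ[volume.restrict (Metric.ball 0 1)] 0 :=
    ae_mono (Measure.restrict_mono Metric.ball_subset_closedBall le_rfl) h1
  have h3 := Measure.eqOn_open_of_ae_eq h2 Metric.isOpen_ball (continuous_rigid a b).continuousOn
    continuousOn_const
  obtain ⟨rfl, rfl⟩ := eq_zero_of_rigid_eq_zero fun x hx => h3 hx
  rfl

/-- The characteristic vectors of a test field. -/
def charPair : TestField →ₗ[ℝ] E3 × E3 := LinearMap.snd ℝ _ _ ∘ₗ testSpace.subtype

/-- Restriction of `L⁶` fields to the body. -/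
def restrictBody : Lp E3 6 (volume : Measure E3) →L[ℝ] Lp E3 6 ((volume : Measure E3).restrict body) :=
  LpToLpRestrictCLM E3 E3 ℝ volume 6 body

theorem restrictBody_toL6 (u : TestField) : restrictBody (toL6 u) = rigidL6 (charPair u) := by
  apply Lp.ext
  refine (LpToLpRestrictCLM_coeFn ℝ body (toL6 u)).trans ?_
  have h1 : toL6 u =ᵐ[volume.restrict body] u.field := ae_restrict_of_ae (u.memLp_field 6).coeFn_toLp
  refine h1.trans ?_
  refine EventuallyEq.trans ?_ (memLp_rigid u.trans u.ang).coeFn_toLp.symm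
  refine (ae_restrict_mem measurableSet_closedBall).mono fun x hx => ?_
  exact u.isTestField.rigid_near.self_of_nhdsSet x hx

/-- An injective linear map on a finite-dimensional space is bounded below, so the `L⁶` norm on the
body, and with it the Dirichlet norm, controls the characteristic vectors. -/
theorem exists_norm_charPair_le : ∃ c : ℝ, ∀ u, ‖charPair u‖ ≤ c * ‖gradK u‖ := by
  obtain ⟨c, hc⟩ := exists_norm_toL6_le
  obtain ⟨k, -, hk⟩ := rigidL6.exists_antilipschitzWith (LinearMap.ker_eq_bot.2 rigidL6_injective)
  refine ⟨k * (‖restrictBody‖ * c), fun u => ?_⟩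
  have h1 : ‖charPair u‖ ≤ k * ‖rigidL6 (charPair u)‖ := by
    simpa using hk.le_mul_dist (charPair u) 0
  rw [← restrictBody_toL6] at h1
  have h2 := (restrictBody.le_opNorm (toL6 u)).trans
    (mul_le_mul_of_nonneg_left (hc u) (norm_nonneg _))
  calc _ ≤ _ := h1
    _ ≤ k * (‖restrictBody‖ * (c * ‖gradK u‖)) := mul_le_mul_of_nonneg_left h2 k.2
    _ = _ := by ring

/-- The characteristic vectors of an element of `GradSpace`. -/
def charVec : GradSpace →L[ℝ] E3 × E3 := charPair.extendOfNorm gradK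

theorem charVec_gradK (u : TestField) : charVec (gradK u) = (u.trans, u.ang) :=
  LinearMap.extendOfNorm_eq denseRange_gradK exists_norm_charPair_le u

/-- The Galerkin lemma needs injectivity. Elements of `testSpace` carry their characteristic vectors
as data, so both the field and these vectors have to be shown to vanish. -/
theorem gradK_injective : Function.Injective gradK := by
  rw [← LinearMap.ker_eq_bot, LinearMap.ker_eq_bot']
  intro u hu
  have h1 : toL6 u = 0 := by rw [← velocity_gradK, hu, map_zero]
  have h2 : charPair u = 0 := by
    have := charVec_gradK u
    rw [hu, map_zero] at this
    exact this.symm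
  have h3 : u.field =ᵐ[volume] 0 :=
    (u.memLp_field 6).coeFn_toLp.symm.trans (by
      have : (u.memLp_field 6).toLp _ = 0 := h1
      rw [this]; exact Lp.coeFn_zero _ _ _)
  have h4 : u.field = 0 := (Continuous.ae_eq_iff_eq volume u.isTestField.smooth.continuous
    continuous_const).1 h3
  exact Subtype.ext (Prod.ext h4 h2)

theorem hasCharVectors_velocity (g : GradSpace) :
    HasCharVectors (velocity g) (charVec g).1 (charVec g).2 := by
  have h : restrictBody (velocity g) = rigidL6 (charVec g) := by
    refine denseRange_gradK.induction_on (p := fun g => restrictBody (velocity g) = rigidL6 (charVec g))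
      g ?_ fun u => ?_
    · exact isClosed_eq (restrictBody.continuous.comp velocity.continuous)
        ((LinearMap.continuous_of_finiteDimensional rigidL6).comp charVec.continuous)
    · rw [velocity_gradK, charVec_gradK, restrictBody_toL6]
      rfl
  refine (LpToLpRestrictCLM_coeFn ℝ body (velocity g)).symm.trans ?_
  change restrictBody (velocity g) =ᵐ[_] _
  rw [h]
  exact (memLp_rigid _ _).coeFn_toLp

/-! ### Local compactness -/

/-- Cauchy–Schwarz against the constant `1`. -/
theorem sq_lintegral_le {X : Type*} [MeasurableSpace X] {μ : Measure X} {f : X → ENNReal}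
    (hf : AEMeasurable f μ) : (∫⁻ x, f x ∂μ) ^ 2 ≤ μ Set.univ * ∫⁻ x, f x ^ 2 ∂μ := by
  have h := ENNReal.lintegral_mul_le_Lp_mul_Lq μ Real.HolderConjugate.two_two hf
    (aemeasurable_const (b := (1 : ENNReal)))
  simp only [Pi.mul_apply, mul_one, ENNReal.one_rpow, lintegral_one] at h
  have h2 := pow_le_pow_left' h 2
  rw [mul_pow, ← ENNReal.rpow_natCast, ← ENNReal.rpow_natCast (_ ^ (1 / 2 : ℝ)),
    ← ENNReal.rpow_natCast (_ ^ (1 / 2 : ℝ)), ← ENNReal.rpow_mul, ← ENNReal.rpow_mul] at h2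
  norm_num at h2
  rw [mul_comm]
  simpa using h2

theorem ennreal_add_sq_le (a b : ENNReal) : (a + b) ^ 2 ≤ 4 * (a ^ 2 + b ^ 2) := by
  have key : ∀ a b : ENNReal, a ≤ b → (a + b) ^ 2 ≤ 4 * (a ^ 2 + b ^ 2) := fun a b h => by
    calc (a + b) ^ 2 ≤ (b + b) ^ 2 := by gcongr
      _ = 4 * b ^ 2 := by ring
      _ ≤ _ := by gcongr; exact le_add_self
  rcases le_total a b with h | h
  · exact key a b h
  · rw [add_comm a, add_comm (a ^ 2)]
    exact key b a h

/-- Translations of a `C¹` field are controlled in `L²` by its derivative. -/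
theorem lintegral_translate_sub_le {φ : E3 → E3} (hφ : ContDiff ℝ 1 φ) (h : E3) :
    ∫⁻ x, ‖φ (x + h) - φ x‖ₑ ^ 2 ≤ ‖h‖ₑ ^ 2 * ∫⁻ x, ‖fderiv ℝ φ x‖ₑ ^ 2 := by
  have hc : Continuous (fderiv ℝ φ) := hφ.continuous_fderiv one_ne_zero
  -- The fundamental theorem of calculus along the segment from `x` to `x + h`, then Cauchy–Schwarz
  -- in `t`. Translation invariance later removes the shift `t • h`.
  have hpt : ∀ x, ‖φ (x + h) - φ x‖ₑ ^ 2 ≤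
      ‖h‖ₑ ^ 2 * ∫⁻ t in Set.Ioc (0 : ℝ) 1, ‖fderiv ℝ φ (x + t • h)‖ₑ ^ 2 := by
    intro x
    have hd : ∀ t : ℝ, HasDerivAt (fun t : ℝ => φ (x + t • h)) (fderiv ℝ φ (x + t • h) h) t := by
      intro t
      have h1 : HasDerivAt (fun t : ℝ => x + t • h) h t := by
        simpa using ((hasDerivAt_id t).smul_const h).const_add x
      exact ((hφ.differentiable one_ne_zero) _).hasFDerivAt.comp_hasDerivAt t h1
    have hi := intervalIntegral.integral_eq_sub_of_hasDerivAt (a := 0) (b := 1) (fun t _ => hd t)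
      (Continuous.intervalIntegrable (by fun_prop) _ _)
    simp only [one_smul, zero_smul, add_zero] at hi
    rw [← hi, intervalIntegral.integral_of_le zero_le_one]
    calc ‖∫ t in Set.Ioc (0 : ℝ) 1, fderiv ℝ φ (x + t • h) h‖ₑ ^ 2
        ≤ (∫⁻ t in Set.Ioc (0 : ℝ) 1, ‖fderiv ℝ φ (x + t • h) h‖ₑ) ^ 2 := by
          gcongr; exact enorm_integral_le_lintegral_enorm _
      _ ≤ (∫⁻ t in Set.Ioc (0 : ℝ) 1, ‖fderiv ℝ φ (x + t • h)‖ₑ * ‖h‖ₑ) ^ 2 := by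
          gcongr; exact ContinuousLinearMap.le_opENorm _ _
      _ = ‖h‖ₑ ^ 2 * (∫⁻ t in Set.Ioc (0 : ℝ) 1, ‖fderiv ℝ φ (x + t • h)‖ₑ) ^ 2 := by
          rw [lintegral_mul_const' _ _ enorm_ne_top, mul_pow, mul_comm]
      _ ≤ _ := by
          gcongr
          refine (sq_lintegral_le (Continuous.aemeasurable (by fun_prop))).trans ?_
          simp
  calc ∫⁻ x, ‖φ (x + h) - φ x‖ₑ ^ 2
      ≤ ∫⁻ x, ‖h‖ₑ ^ 2 * ∫⁻ t in Set.Ioc (0 : ℝ) 1, ‖fderiv ℝ φ (x + t • h)‖ₑ ^ 2 :=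
        lintegral_mono hpt
    _ = ‖h‖ₑ ^ 2 * ∫⁻ x, ∫⁻ t in Set.Ioc (0 : ℝ) 1, ‖fderiv ℝ φ (x + t • h)‖ₑ ^ 2 :=
        lintegral_const_mul' _ _ (by finiteness)
    _ = ‖h‖ₑ ^ 2 * ∫⁻ t in Set.Ioc (0 : ℝ) 1, ∫⁻ x, ‖fderiv ℝ φ (x + t • h)‖ₑ ^ 2 := by
        rw [lintegral_lintegral_swap]
        exact (Continuous.measurable (by fun_prop)).aemeasurable
    _ = _ := by
        simp_rw [lintegral_add_right_eq_self (fun x => ‖fderiv ℝ φ x‖ₑ ^ 2)]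
        simp

/-- A Poincaré-type inequality on a set of finite measure. -/
theorem lintegral_sq_le_double {w : E3 → E3} (hw : Continuous w) {Q : Set E3}
    (hQ : volume Q ≠ ⊤) (hi : IntegrableOn w Q) :
    volume Q * ∫⁻ x in Q, ‖w x‖ₑ ^ 2 ≤
      4 * (∫⁻ x in Q, ∫⁻ y in Q, ‖w y - w x‖ₑ ^ 2) + 4 * ‖∫ y in Q, w y‖ₑ ^ 2 := by
  rcases eq_or_ne (volume Q) 0 with h0 | h0
  · simp [h0]
  have hpt : ∀ x, volume Q * (volume Q * ‖w x‖ₑ ^ 2) ≤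
      4 * (volume Q * ∫⁻ y in Q, ‖w y - w x‖ₑ ^ 2) + 4 * ‖∫ y in Q, w y‖ₑ ^ 2 := by
    intro x
    -- The value at `x` is split into the mean over `Q` and the mean deviation from it. Everything
    -- carries an extra factor `volume Q`, cancelled at the end.
    have h1 : volume.real Q • w x = (∫ y in Q, w y) - ∫ y in Q, (w y - w x) := by
      rw [integral_sub hi (integrableOn_const hQ), setIntegral_const]
      abel
    have h2 : volume Q * ‖w x‖ₑ ≤ (∫⁻ y in Q, ‖w y - w x‖ₑ) + ‖∫ y in Q, w y‖ₑ := by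
      have : volume Q * ‖w x‖ₑ = ‖volume.real Q • w x‖ₑ := by
        rw [enorm_smul, Measure.real, Real.enorm_of_nonneg ENNReal.toReal_nonneg,
          ENNReal.ofReal_toReal hQ]
      rw [this, h1, add_comm (∫⁻ _ in Q, _)]
      refine (enorm_sub_le).trans ?_
      gcongr
      exact enorm_integral_le_lintegral_enorm _
    calc volume Q * (volume Q * ‖w x‖ₑ ^ 2) = (volume Q * ‖w x‖ₑ) ^ 2 := by ring
      _ ≤ 4 * ((∫⁻ y in Q, ‖w y - w x‖ₑ) ^ 2 + ‖∫ y in Q, w y‖ₑ ^ 2) :=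
        (pow_le_pow_left' h2 2).trans (ennreal_add_sq_le _ _)
      _ ≤ _ := by
        rw [mul_add]
        gcongr
        refine (sq_lintegral_le (Continuous.aemeasurable (by fun_prop))).trans ?_
        simp
  have hint : volume Q * (volume Q * ∫⁻ x in Q, ‖w x‖ₑ ^ 2) ≤
      volume Q * (4 * (∫⁻ x in Q, ∫⁻ y in Q, ‖w y - w x‖ₑ ^ 2) + 4 * ‖∫ y in Q, w y‖ₑ ^ 2) := by
    calc volume Q * (volume Q * ∫⁻ x in Q, ‖w x‖ₑ ^ 2)
        = ∫⁻ x in Q, volume Q * (volume Q * ‖w x‖ₑ ^ 2) := by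
          rw [lintegral_const_mul' _ _ hQ, lintegral_const_mul' _ _ hQ]
      _ ≤ ∫⁻ x in Q, (4 * (volume Q * ∫⁻ y in Q, ‖w y - w x‖ₑ ^ 2) + 4 * ‖∫ y in Q, w y‖ₑ ^ 2) :=
          lintegral_mono hpt
      _ = _ := by
          rw [lintegral_add_right _ measurable_const, lintegral_const_mul' _ _ (by finiteness),
            lintegral_const_mul' _ _ hQ, setLIntegral_const]
          ring
  exact (ENNReal.mul_le_mul_iff_right h0 hQ).1 hint

/-- The cube with index `k` of the grid of mesh `h`. -/
def cube (h : ℝ) (k : Fin 3 → ℤ) : Set E3 := {x | ∀ i, ⌊x i / h⌋ = k i}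

theorem measurableSet_cube (h : ℝ) (k : Fin 3 → ℤ) : MeasurableSet (cube h k) := by
  have : cube h k = ⋂ i, (fun x : E3 => ⌊x i / h⌋) ⁻¹' {k i} := by
    ext x; simp [cube]
  rw [this]
  exact MeasurableSet.iInter fun i =>
    (Int.measurable_floor.comp (by fun_prop : Measurable fun x : E3 => x i / h))
      (measurableSet_singleton _)

theorem disjoint_cube (h : ℝ) {k l : Fin 3 → ℤ} (hkl : k ≠ l) : Disjoint (cube h k) (cube h l) :=
  Set.disjoint_left.2 fun _ hk hl => hkl (funext fun i => (hk i).symm.trans (hl i))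

theorem abs_apply_le_norm (y : E3) (i : Fin 3) : |y i| ≤ ‖y‖ := PiLp.norm_apply_le y i

theorem norm_sub_le_of_mem_cube {h : ℝ} (hh : 0 < h) {k : Fin 3 → ℤ} {x y : E3} (hx : x ∈ cube h k)
    (hy : y ∈ cube h k) : ‖y - x‖ ≤ 3 * h := by
  have hi : ∀ i, |(y - x) i| ≤ h := by
    intro i
    have h1 := Int.abs_sub_lt_one_of_floor_eq_floor ((hy i).trans (hx i).symm)
    rw [← sub_div, abs_div, abs_of_pos hh, div_lt_one hh] at h1
    exact h1.le
  refine (norm_le_sum_abs _).trans ?_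
  rw [Fin.sum_univ_three]
  linarith [hi 0, hi 1, hi 2]

theorem ball_subset_cube {h : ℝ} (hh : 0 < h) (k : Fin 3 → ℤ) :
    Metric.ball (WithLp.toLp 2 fun i => h * (k i + 1 / 2) : E3) (h / 2) ⊆ cube h k := by
  intro x hx i
  rw [mem_ball_iff_norm] at hx
  have h1 := (abs_apply_le_norm _ i).trans_lt hx
  simp only [PiLp.sub_apply] at h1
  rw [abs_lt] at h1
  rw [Int.floor_eq_iff, le_div_iff₀ hh, div_lt_iff₀ hh]
  constructor <;> nlinarith [h1.1, h1.2]

theorem cube_subset_closedBall {h : ℝ} (hh : 0 < h) {k : Fin 3 → ℤ} {x : E3} (hx : x ∈ cube h k) :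
    cube h k ⊆ Metric.closedBall x (3 * h) := fun y hy => by
  rw [mem_closedBall_iff_norm]
  exact norm_sub_le_of_mem_cube hh hx hy

theorem volume_ball_le_cube {h : ℝ} (hh : 0 < h) (k : Fin 3 → ℤ) :
    volume (Metric.ball (0 : E3) (h / 2)) ≤ volume (cube h k) := by
  rw [← Measure.addHaar_ball_center volume (WithLp.toLp 2 fun i => h * (k i + 1 / 2) : E3)]
  exact measure_mono (ball_subset_cube hh k)

theorem volume_cube_lt_top {h : ℝ} (hh : 0 < h) (k : Fin 3 → ℤ) : volume (cube h k) < ⊤ := by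
  have hc : (WithLp.toLp 2 fun i => h * (k i + 1 / 2) : E3) ∈ cube h k :=
    ball_subset_cube hh k (Metric.mem_ball_self (by positivity))
  exact (measure_mono (cube_subset_closedBall hh hc)).trans_lt measure_closedBall_lt_top

theorem exists_cubes_cover {h : ℝ} (hh : 0 < h) (R : ℝ) :
    ∃ S : Finset (Fin 3 → ℤ), Metric.closedBall (0 : E3) R ⊆ ⋃ k ∈ S, cube h k := by
  refine ⟨Fintype.piFinset fun _ => Finset.Icc ⌊-R / h⌋ ⌊R / h⌋, fun x hx => ?_⟩
  simp only [Set.mem_iUnion]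
  refine ⟨fun i => ⌊x i / h⌋, ?_, fun i => rfl⟩
  rw [Fintype.mem_piFinset]
  intro i
  have h1 := abs_le.1 ((abs_apply_le_norm x i).trans (by simpa using hx))
  rw [Finset.mem_Icc]
  exact ⟨Int.floor_le_floor (by gcongr; exact h1.1), Int.floor_le_floor (by gcongr; exact h1.2)⟩

/-- The mean oscillation over the cubes of a grid is controlled by the derivative. -/
theorem sum_lintegral_cube_le {w : E3 → E3} (hw : ContDiff ℝ 1 w) {h : ℝ} (hh : 0 < h)
    (S : Finset (Fin 3 → ℤ)) :
    ∑ k ∈ S, ∫⁻ x in cube h k, ∫⁻ y in cube h k, ‖w y - w x‖ₑ ^ 2 ≤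
      volume (Metric.closedBall (0 : E3) (3 * h)) *
        (ENNReal.ofReal (3 * h) ^ 2 * ∫⁻ x, ‖fderiv ℝ w x‖ₑ ^ 2) := by
  have hc : Continuous w := hw.continuous
  set W := Metric.closedBall (0 : E3) (3 * h)
  -- The inner cube is enlarged to the ball of radius `3h` about `x`, and `y = x + z` makes the
  -- domain of `z` independent of the cube.
  have h1 : ∀ k ∈ S, ∫⁻ x in cube h k, ∫⁻ y in cube h k, ‖w y - w x‖ₑ ^ 2 ≤
      ∫⁻ x in cube h k, ∫⁻ z in W, ‖w (x + z) - w x‖ₑ ^ 2 := by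
    intro k _
    refine setLIntegral_mono' (measurableSet_cube h k) fun x hx => ?_
    calc ∫⁻ y in cube h k, ‖w y - w x‖ₑ ^ 2
        ≤ ∫⁻ y in Metric.closedBall x (3 * h), ‖w y - w x‖ₑ ^ 2 :=
          lintegral_mono_set (cube_subset_closedBall hh hx)
      _ = ∫⁻ z in W, ‖w (x + z) - w x‖ₑ ^ 2 := by
          rw [← lintegral_indicator measurableSet_closedBall,
            ← lintegral_indicator measurableSet_closedBall,
            ← lintegral_add_left_eq_self _ x]
          congr 1
          ext z
          simp [Set.indicator]
  calc _ ≤ ∑ k ∈ S, ∫⁻ x in cube h k, ∫⁻ z in W, ‖w (x + z) - w x‖ₑ ^ 2 := Finset.sum_le_sum h1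
    _ = ∫⁻ x in ⋃ k ∈ S, cube h k, ∫⁻ z in W, ‖w (x + z) - w x‖ₑ ^ 2 :=
        (lintegral_biUnion_finset (fun k _ l _ hkl => disjoint_cube h hkl)
          (fun k _ => measurableSet_cube h k) _).symm
    _ ≤ ∫⁻ x, ∫⁻ z in W, ‖w (x + z) - w x‖ₑ ^ 2 := setLIntegral_le_lintegral _ _
    _ = ∫⁻ z in W, ∫⁻ x, ‖w (x + z) - w x‖ₑ ^ 2 := by
        rw [lintegral_lintegral_swap]
        exact (Continuous.measurable (by fun_prop)).aemeasurable
    _ ≤ ∫⁻ z in W, ENNReal.ofReal (3 * h) ^ 2 * ∫⁻ x, ‖fderiv ℝ w x‖ₑ ^ 2 := by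
        refine setLIntegral_mono' measurableSet_closedBall fun z hz => ?_
        refine (lintegral_translate_sub_le hw z).trans ?_
        gcongr
        rw [← ofReal_norm]
        exact ENNReal.ofReal_le_ofReal (by simpa [W] using hz)
    _ = _ := by rw [setLIntegral_const, mul_comm]

/-- Local `L²` bound by a small multiple of the gradient and finitely many averages. -/
theorem lintegral_sq_closedBall_le {w : E3 → E3} (hw : ContDiff ℝ 1 w) {h R : ℝ} (hh : 0 < h)
    {S : Finset (Fin 3 → ℤ)} (hS : Metric.closedBall (0 : E3) R ⊆ ⋃ k ∈ S, cube h k) :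
    ∫⁻ x in Metric.closedBall (0 : E3) R, ‖w x‖ₑ ^ 2 ≤
      864 * (ENNReal.ofReal (3 * h) ^ 2 * ∫⁻ x, ‖fderiv ℝ w x‖ₑ ^ 2) +
      4 / volume (Metric.ball (0 : E3) (h / 2)) * ∑ k ∈ S, ‖∫ x in cube h k, w x‖ₑ ^ 2 := by
  -- The radii have ratio `6`, so the volumes have ratio `6³ = 216`; together with the factor `4` of
  -- the Poincaré inequality this gives `864`.
  have hW : volume (Metric.closedBall (0 : E3) (3 * h)) =
      216 * volume (Metric.ball (0 : E3) (h / 2)) := by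
    rw [Measure.addHaar_closedBall _ _ (by positivity),
      Measure.addHaar_ball volume (0 : E3) (r := h / 2) (by positivity), ← mul_assoc]
    congr 1
    rw [show (216 : ENNReal) = ENNReal.ofReal 216 by simp, ← ENNReal.ofReal_mul (by norm_num)]
    congr 1
    simp
    ring
  set β := volume (Metric.ball (0 : E3) (h / 2)) with hβ
  have hβ0 : β ≠ 0 := (Metric.measure_ball_pos volume _ (by positivity)).ne'
  have hβt : β ≠ ⊤ := measure_ball_lt_top.ne
  have hcube : ∀ k, IntegrableOn w (cube h k) := fun k => by
    have hc : (WithLp.toLp 2 fun i => h * (k i + 1 / 2) : E3) ∈ cube h k :=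
      ball_subset_cube hh k (Metric.mem_ball_self (by positivity))
    exact (hw.continuous.continuousOn.integrableOn_compact
      (isCompact_closedBall _ _)).mono_set (cube_subset_closedBall hh hc)
  have main : β * ∫⁻ x in Metric.closedBall (0 : E3) R, ‖w x‖ₑ ^ 2 ≤
      4 * (216 * β * (ENNReal.ofReal (3 * h) ^ 2 * ∫⁻ x, ‖fderiv ℝ w x‖ₑ ^ 2)) +
      4 * ∑ k ∈ S, ‖∫ x in cube h k, w x‖ₑ ^ 2 := by
    calc β * ∫⁻ x in Metric.closedBall (0 : E3) R, ‖w x‖ₑ ^ 2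
        ≤ β * ∫⁻ x in ⋃ k ∈ S, cube h k, ‖w x‖ₑ ^ 2 := by
          gcongr
      _ = ∑ k ∈ S, β * ∫⁻ x in cube h k, ‖w x‖ₑ ^ 2 := by
          rw [lintegral_biUnion_finset (fun k _ l _ hkl => disjoint_cube h hkl)
            (fun k _ => measurableSet_cube h k), Finset.mul_sum]
      _ ≤ ∑ k ∈ S, (4 * (∫⁻ x in cube h k, ∫⁻ y in cube h k, ‖w y - w x‖ₑ ^ 2) +
            4 * ‖∫ y in cube h k, w y‖ₑ ^ 2) := by
          refine Finset.sum_le_sum fun k _ => ?_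
          refine le_trans ?_ (lintegral_sq_le_double hw.continuous (volume_cube_lt_top hh k).ne
            (hcube k))
          gcongr
          exact volume_ball_le_cube hh k
      _ ≤ _ := by
          rw [Finset.sum_add_distrib, ← Finset.mul_sum, ← Finset.mul_sum, ← hW]
          gcongr
          exact sum_lintegral_cube_le hw hh S
  have := mul_le_mul_right main β⁻¹
  rw [← mul_assoc, ENNReal.inv_mul_cancel hβ0 hβt, one_mul] at this
  refine this.trans_eq ?_
  rw [mul_add]
  congr 1
  · calc β⁻¹ * (4 * (216 * β * (ENNReal.ofReal (3 * h) ^ 2 * ∫⁻ x, ‖fderiv ℝ w x‖ₑ ^ 2)))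
        = (β⁻¹ * β) * (864 * (ENNReal.ofReal (3 * h) ^ 2 * ∫⁻ x, ‖fderiv ℝ w x‖ₑ ^ 2)) := by ring
      _ = _ := by rw [ENNReal.inv_mul_cancel hβ0 hβt, one_mul]
  · rw [ENNReal.div_eq_inv_mul, mul_assoc]

/-! ### Multiplication operators and strong local convergence -/

instance : ENNReal.HolderTriple 3 6 2 :=
  ⟨by
    rw [← ENNReal.toReal_eq_toReal_iff' (by simp) (by simp), ENNReal.toReal_add (by simp) (by simp)]
    norm_num⟩

instance : ENNReal.HolderConjugate (6 / 5) 6 :=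
  ⟨by
    have h : (6 / 5 : ENNReal)⁻¹ = 5 / 6 := ENNReal.inv_div (by simp) (by simp)
    rw [h, ← ENNReal.toReal_eq_toReal_iff' (by simp [ENNReal.div_eq_top]) (by simp),
      ENNReal.toReal_add (by simp [ENNReal.div_eq_top]) (by simp), ENNReal.toReal_div]
    norm_num⟩

instance : Fact ((1 : ENNReal) ≤ 6 / 5) :=
  ⟨by rw [ENNReal.le_div_iff_mul_le (by simp) (by simp)]; norm_num⟩

instance : Fact ((1 : ENNReal) ≤ 3) := ⟨by norm_num⟩

/-- Multiplication of the `j`-th component of an `L⁶` field by a function in `L³`. -/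
def mulComp (f : Lp ℝ 3 (volume : Measure E3)) (j : Fin 3) :
    Lp E3 6 (volume : Measure E3) →L[ℝ] Lp ℝ 2 (volume : Measure E3) :=
  ((ContinuousLinearMap.mul ℝ ℝ).bilinearComp (ContinuousLinearMap.id ℝ ℝ)
    (EuclideanSpace.proj j : E3 →L[ℝ] ℝ)).holderL volume 3 6 2 f

theorem coeFn_mulComp (f : Lp ℝ 3 (volume : Measure E3)) (j : Fin 3)
    (w : Lp E3 6 (volume : Measure E3)) :
    mulComp f j w =ᵐ[volume] fun x => f x * w x j :=
  ((ContinuousLinearMap.mul ℝ ℝ).bilinearComp (ContinuousLinearMap.id ℝ ℝ)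
    (EuclideanSpace.proj j : E3 →L[ℝ] ℝ)).coeFn_holder (r := 2) f w

/-- The weighted mean `∫ f w` of an `L⁶` field. -/
def weightedMean (f : Lp ℝ (6 / 5) (volume : Measure E3)) : Lp E3 6 (volume : Measure E3) →L[ℝ] E3 :=
  (ContinuousLinearMap.lsmul ℝ ℝ).lpPairing volume (6 / 5) 6 f

theorem weightedMean_apply {f : E3 → ℝ} (hf : MemLp f (6 / 5) volume)
    {v : E3 → E3} {w : Lp E3 6 (volume : Measure E3)} (hw : w =ᵐ[volume] v) :
    weightedMean (hf.toLp f) w = ∫ x, f x • v x := by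
  rw [weightedMean, ContinuousLinearMap.lpPairing_eq_integral]
  refine integral_congr_ae ?_
  filter_upwards [hf.coeFn_toLp, hw] with x h1 h2
  simp [h1, h2]

theorem coeFn_toL6 (u : TestField) : toL6 u =ᵐ[volume] u.field :=
  (u.memLp_field 6).coeFn_toLp

/-- Weak convergence in `GradSpace`. -/
def WeakTendsto {I : Type*} (x : I → GradSpace) (U : Filter I) (g : GradSpace) : Prop :=
  ∀ Λ : GradSpace →L[ℝ] ℝ, Tendsto (fun i => Λ (x i)) U (𝓝 (Λ g))

/-- The target is finite-dimensional, so convergence of each coordinate is convergence in norm. -/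
theorem WeakTendsto.apply {I : Type*} {x : I → GradSpace} {U : Filter I} {g : GradSpace}
    (h : WeakTendsto x U g) (L : GradSpace →L[ℝ] E3) :
    Tendsto (fun i => L (x i)) U (𝓝 (L g)) := by
  rw [tendsto_iff_norm_sub_tendsto_zero]
  have h1 : ∀ j, Tendsto (fun i => |(L (x i) - L g) j|) U (𝓝 0) := by
    intro j
    have := (h ((EuclideanSpace.proj j : E3 →L[ℝ] ℝ) ∘L L)).sub_const (L g j)
    simpa using this.abs
  refine squeeze_zero (fun _ => norm_nonneg _) (fun i => norm_le_sum_abs _) ?_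
  simpa using tendsto_finsetSum (Finset.univ : Finset (Fin 3)) fun j _ => h1 j

theorem eLpNorm_two_sq {F : Type*} [NormedAddCommGroup F] (f : E3 → F) :
    eLpNorm f 2 volume ^ 2 = ∫⁻ x, ‖f x‖ₑ ^ 2 := by
  have := eLpNorm_nnreal_pow_eq_lintegral (f := f) (μ := (volume : Measure E3)) (p := 2) two_ne_zero
  simpa using this

theorem memLp_indicator_cube {h : ℝ} (hh : 0 < h) (k : Fin 3 → ℤ) :
    MemLp ((cube h k).indicator fun _ => (1 : ℝ)) (6 / 5) (volume : Measure E3) :=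
  memLp_indicator_const _ (measurableSet_cube h k) _ (Or.inr (volume_cube_lt_top hh k).ne)

/-- The mean over a cube. -/
def cubeMean {h : ℝ} (hh : 0 < h) (k : Fin 3 → ℤ) : GradSpace →L[ℝ] E3 :=
  weightedMean ((memLp_indicator_cube hh k).toLp _) ∘L velocity

theorem cubeMean_gradK {h : ℝ} (hh : 0 < h) (k : Fin 3 → ℤ) (u : TestField) :
    cubeMean hh k (gradK u) = ∫ x in cube h k, u.field x := by
  rw [cubeMean, ContinuousLinearMap.comp_apply, velocity_gradK,
    weightedMean_apply _ (coeFn_toL6 u), ← integral_indicator (measurableSet_cube h k)]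
  congr 1
  ext1 x
  by_cases hx : x ∈ cube h k <;> simp [hx]

theorem coeFn_mulComp_gradK {f : E3 → ℝ} (hf : MemLp f 3 volume) (j : Fin 3) (u : TestField) :
    mulComp (hf.toLp f) j (velocity (gradK u)) =ᵐ[volume] fun x => f x * u.field x j := by
  refine (coeFn_mulComp _ _ _).trans ?_
  rw [velocity_gradK]
  filter_upwards [hf.coeFn_toLp, coeFn_toL6 u] with x h1 h2
  rw [h1, h2]

theorem ofReal_norm_mulComp_sq_le {f : E3 → ℝ} (hf : MemLp f 3 volume) {F R : ℝ}
    (hF : ∀ x, ‖f x‖ ≤ F) (hR : ∀ x, x ∉ Metric.closedBall (0 : E3) R → f x = 0)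
    (j : Fin 3) (u : TestField) :
    ENNReal.ofReal (‖mulComp (hf.toLp f) j (velocity (gradK u))‖ ^ 2) ≤
      ENNReal.ofReal F ^ 2 * ∫⁻ x in Metric.closedBall (0 : E3) R, ‖u.field x‖ₑ ^ 2 := by
  rw [ENNReal.ofReal_pow (norm_nonneg _), ofReal_norm, Lp.enorm_def,
    eLpNorm_congr_ae (coeFn_mulComp_gradK hf j u),
    eLpNorm_two_sq, ← lintegral_const_mul' _ _ (by finiteness),
    ← lintegral_indicator measurableSet_closedBall]
  refine lintegral_mono fun x => ?_
  by_cases hx : x ∈ Metric.closedBall (0 : E3) R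
  · rw [Set.indicator_of_mem hx, enorm_mul, mul_pow]
    gcongr
    · rw [← ofReal_norm]; exact ENNReal.ofReal_le_ofReal (hF x)
    · rw [← ofReal_norm, ← ofReal_norm]
      exact ENNReal.ofReal_le_ofReal (abs_apply_le_norm _ j)
  · simp [hR x hx]

/-- The constant is `864 · 3² · 9² = 629856`. -/
theorem ofReal_bound_eq {F h n t s : ℝ} (hF : 0 ≤ F) (hh : 0 ≤ h) (hn : 0 ≤ n) (ht : 0 ≤ t)
    (hs : 0 ≤ s) :
    ENNReal.ofReal F ^ 2 * (864 * (ENNReal.ofReal (3 * h) ^ 2 * ENNReal.ofReal (9 * n) ^ 2)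
      + ENNReal.ofReal t * ENNReal.ofReal s) =
      ENNReal.ofReal (F ^ 2 * 629856 * h ^ 2 * n ^ 2 + F ^ 2 * t * s) := by
  rw [show (864 : ENNReal) = ENNReal.ofReal 864 by simp, ← ENNReal.ofReal_pow (by positivity),
    ← ENNReal.ofReal_pow (by positivity), ← ENNReal.ofReal_pow (by positivity),
    ← ENNReal.ofReal_mul (by positivity), ← ENNReal.ofReal_mul (by positivity),
    ← ENNReal.ofReal_mul (by positivity), ← ENNReal.ofReal_add (by positivity) (by positivity),
    ← ENNReal.ofReal_mul (by positivity)]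
  congr 1
  ring

theorem norm_mulComp_gradK_sq_le {f : E3 → ℝ} (hf : MemLp f 3 volume) {F R : ℝ} (hF0 : 0 ≤ F)
    (hF : ∀ x, ‖f x‖ ≤ F) (hR : ∀ x, x ∉ Metric.closedBall (0 : E3) R → f x = 0)
    (j : Fin 3) {h : ℝ} (hh : 0 < h) {S : Finset (Fin 3 → ℤ)}
    (hS : Metric.closedBall (0 : E3) R ⊆ ⋃ k ∈ S, cube h k) (u : TestField) :
    ‖mulComp (hf.toLp f) j (velocity (gradK u))‖ ^ 2 ≤
      F ^ 2 * 629856 * h ^ 2 * ‖gradK u‖ ^ 2 +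
      F ^ 2 * (4 / volume (Metric.ball (0 : E3) (h / 2))).toReal *
        ∑ k ∈ S, ‖cubeMean hh k (gradK u)‖ ^ 2 := by
  have h2 := ofReal_norm_mulComp_sq_le hf hF hR j u
  have h3 := lintegral_sq_closedBall_le (u.isTestField.smooth.of_le (by exact_mod_cast le_top)) hh hS
  have h4 : ∫⁻ x, ‖fderiv ℝ u.field x‖ₑ ^ 2 ≤ ENNReal.ofReal (9 * ‖gradK u‖) ^ 2 := by
    rw [← eLpNorm_two_sq]
    exact pow_le_pow_left' (eLpNorm_fderiv_le u) 2
  have h5 : ∑ k ∈ S, ‖∫ x in cube h k, u.field x‖ₑ ^ 2 =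
      ENNReal.ofReal (∑ k ∈ S, ‖cubeMean hh k (gradK u)‖ ^ 2) := by
    rw [ENNReal.ofReal_sum_of_nonneg fun _ _ => by positivity]
    refine Finset.sum_congr rfl fun k _ => ?_
    rw [cubeMean_gradK, ENNReal.ofReal_pow (norm_nonneg _), ofReal_norm]
  rw [h5] at h3
  set D := 4 / volume (Metric.ball (0 : E3) (h / 2)) with hD
  have hDt : D ≠ ⊤ := ENNReal.div_ne_top (by simp)
    (Metric.measure_ball_pos volume _ (by positivity)).ne'
  set s := ∑ k ∈ S, ‖cubeMean hh k (gradK u)‖ ^ 2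
  have hs : 0 ≤ s := Finset.sum_nonneg fun _ _ => by positivity
  set n := ‖gradK u‖
  have hn : 0 ≤ n := norm_nonneg _
  set t := D.toReal
  have ht : 0 ≤ t := ENNReal.toReal_nonneg
  have hDt' : D = ENNReal.ofReal t := (ENNReal.ofReal_toReal hDt).symm
  rw [hDt'] at h3
  rw [← ENNReal.ofReal_le_ofReal_iff (by clear_value s n t; positivity),
    ← ofReal_bound_eq hF0 hh.le hn ht hs]
  refine h2.trans ?_
  gcongr
  refine h3.trans ?_
  gcongr

/-- A quantitative Rellich estimate: `A` does not depend on the mesh `h`, so the gradient term is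
made small by refining the grid, and what remains is finitely many cube means, which are weakly
continuous. -/
theorem exists_norm_mulComp_sq_le {f : E3 → ℝ} (hf : Continuous f) (hfc : HasCompactSupport f)
    (j : Fin 3) : ∃ A : ℝ, 0 ≤ A ∧ ∀ (h : ℝ) (hh : 0 < h),
      ∃ (S : Finset (Fin 3 → ℤ)) (D : ℝ), ∀ w : GradSpace,
      ‖mulComp ((hf.memLp_of_hasCompactSupport hfc).toLp f) j (velocity w)‖ ^ 2 ≤
        A * h ^ 2 * ‖w‖ ^ 2 + D * ∑ k ∈ S, ‖cubeMean hh k w‖ ^ 2 := by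
  obtain ⟨F, hF⟩ := hf.bounded_above_of_compact_support hfc
  have hF0 : 0 ≤ F := (norm_nonneg _).trans (hF 0)
  obtain ⟨R, hR⟩ := hfc.isCompact.isBounded.subset_closedBall 0
  refine ⟨F ^ 2 * 629856, by positivity, fun h hh => ?_⟩
  obtain ⟨S, hS⟩ := exists_cubes_cover hh R
  refine ⟨S, F ^ 2 * (4 / volume (Metric.ball (0 : E3) (h / 2))).toReal, fun w => ?_⟩
  refine denseRange_gradK.induction_on w ?_ fun u => ?_
  · refine isClosed_le ?_ ?_
    · exact (((mulComp _ j).continuous.comp velocity.continuous).norm).pow 2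
    · refine (continuous_const.mul (continuous_norm.pow 2)).add (continuous_const.mul ?_)
      exact continuous_finsetSum _ fun k _ => ((cubeMean hh k).continuous.norm).pow 2
  · exact norm_mulComp_gradK_sq_le _ hF0 hF
      (fun x hx => image_eq_zero_of_notMem_tsupport fun h => hx (hR h)) j hh hS u

/-- Weak convergence of gradients implies local strong convergence of the fields. -/
theorem WeakTendsto.mulComp {I : Type*} {x : I → GradSpace} {U : Filter I} {g : GradSpace}
    (hx : WeakTendsto x U g) {M : ℝ} (hM : ∀ i, ‖x i‖ ≤ M) {f : E3 → ℝ} (hf : Continuous f)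
    (hfc : HasCompactSupport f) (j : Fin 3) :
    Tendsto (fun i => mulComp ((hf.memLp_of_hasCompactSupport hfc).toLp f) j (velocity (x i))) U
      (𝓝 (mulComp ((hf.memLp_of_hasCompactSupport hfc).toLp f) j (velocity g))) := by
  obtain ⟨A, hA, H⟩ := exists_norm_mulComp_sq_le hf hfc j
  rw [tendsto_iff_norm_sub_tendsto_zero]
  rw [Metric.tendsto_nhds]
  intro ε hε
  set M' := |M| + ‖g‖ with hM'
  have hM'0 : 0 ≤ M' := by positivity
  -- Since `‖x i - g‖ ≤ M'`, this mesh keeps the gradient term below `ε² / 4`.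
  set h := ε / (2 * (1 + A) * (1 + M')) with hh_def
  have hh : 0 < h := by positivity
  obtain ⟨S, D, hSD⟩ := H h hh
  have hlim : Tendsto (fun i => D * ∑ k ∈ S, ‖cubeMean hh k (x i - g)‖ ^ 2) U (𝓝 0) := by
    have : Tendsto (fun i => D * ∑ k ∈ S, ‖cubeMean hh k (x i - g)‖ ^ 2) U
        (𝓝 (D * ∑ k ∈ S, ‖(0 : E3)‖ ^ 2)) := by
      refine (tendsto_finsetSum S fun k _ => ?_).const_mul D
      refine Tendsto.pow (Tendsto.norm ?_) 2
      have := (hx.apply (cubeMean hh k)).sub_const (cubeMean hh k g)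
      simpa using this
    simpa using this
  filter_upwards [hlim.eventually (gt_mem_nhds (show 0 < ε ^ 2 / 2 by positivity))] with i hi
  rw [dist_zero_right, norm_norm]
  refine lt_of_pow_lt_pow_left₀ 2 hε.le ?_
  have h1 := hSD (x i - g)
  rw [map_sub, map_sub] at h1
  have h2 : ‖x i - g‖ ≤ M' := (norm_sub_le _ _).trans
    (add_le_add ((hM i).trans (le_abs_self M)) le_rfl)
  have h3 : A * h ^ 2 * ‖x i - g‖ ^ 2 ≤ ε ^ 2 / 4 := by
    have : h * (2 * (1 + A) * (1 + M')) = ε := div_mul_cancel₀ _ (by positivity)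
    calc A * h ^ 2 * ‖x i - g‖ ^ 2 ≤ (1 + A) ^ 2 * h ^ 2 * (1 + M') ^ 2 := by
          gcongr
          · nlinarith
          · linarith
      _ = ε ^ 2 / 4 := by rw [← this]; ring
  nlinarith [sq_nonneg ε]

/-! ### Integration by parts -/

theorem integral_fderiv_apply_eq_zero {f : E3 → ℝ} (hf : ContDiff ℝ 1 f) (hfc : HasCompactSupport f)
    (v : E3) : ∫ x, fderiv ℝ f x v = 0 := by
  have hd : Continuous fun x => fderiv ℝ f x v := (hf.continuous_fderiv one_ne_zero).clm_apply continuous_const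
  have h1 : Integrable fun x => fderiv ℝ f x v :=
    hd.integrable_of_hasCompactSupport (hfc.fderiv_apply (𝕜 := ℝ) v)
  have h2 : Integrable f := hf.continuous.integrable_of_hasCompactSupport hfc
  have := integral_mul_fderiv_eq_neg_fderiv_mul_of_integrable (μ := (volume : Measure E3))
    (f := fun _ => (1 : ℝ)) (g := f) (v := v) (by simp) (by simpa using h1) (by simpa using h2)
    (fun x _ => differentiableAt_const _) (fun x _ => (hf.differentiable one_ne_zero) x)
  simpa using this

theorem integral_mul_fderiv_eq {f g : E3 → ℝ} (hf : ContDiff ℝ 1 f) (hfc : HasCompactSupport f)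
    (hg : ContDiff ℝ 1 g) (v : E3) :
    ∫ x, f x * fderiv ℝ g x v = - ∫ x, fderiv ℝ f x v * g x := by
  have hdf : Continuous fun x => fderiv ℝ f x v := (hf.continuous_fderiv one_ne_zero).clm_apply continuous_const
  have hdg : Continuous fun x => fderiv ℝ g x v := (hg.continuous_fderiv one_ne_zero).clm_apply continuous_const
  exact integral_mul_fderiv_eq_neg_fderiv_mul_of_integrable
    ((hdf.mul hg.continuous).integrable_of_hasCompactSupport (hfc.fderiv_apply (𝕜 := ℝ) v).mul_right)
    ((hf.continuous.mul hdg).integrable_of_hasCompactSupport hfc.mul_right)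
    ((hf.continuous.mul hg.continuous).integrable_of_hasCompactSupport hfc.mul_right)
    (fun x _ => (hf.differentiable one_ne_zero) x) (fun x _ => (hg.differentiable one_ne_zero) x)

/-- Two integrations by parts, with the symmetry of the second derivative of `g` in between. -/
theorem integral_fderiv_mul_fderiv_swap {f g : E3 → ℝ} (hf : ContDiff ℝ ∞ f)
    (hfc : HasCompactSupport f) (hg : ContDiff ℝ ∞ g) (v w : E3) :
    ∫ x, fderiv ℝ f x v * fderiv ℝ g x w = ∫ x, fderiv ℝ f x w * fderiv ℝ g x v := by
  have hdg : ∀ v, ContDiff ℝ ∞ fun x => fderiv ℝ g x v := fun v =>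
    (hg.fderiv_right (m := ∞) (by simp)).clm_apply contDiff_const
  have hf1 : ContDiff ℝ 1 f := hf.of_le (by exact_mod_cast le_top)
  have hdg1 : ∀ v, ContDiff ℝ 1 fun x => fderiv ℝ g x v := fun v =>
    (hdg v).of_le (by exact_mod_cast le_top)
  have hsym : ∀ x, fderiv ℝ (fun y => fderiv ℝ g y w) x v = fderiv ℝ (fun y => fderiv ℝ g y v) x w := by
    intro x
    have h1 : DifferentiableAt ℝ (fderiv ℝ g) x :=
      (hg.fderiv_right (m := ∞) (by simp)).differentiable (by simp) x
    have h2 : IsSymmSndFDerivAt ℝ g x := hg.contDiffAt.isSymmSndFDerivAt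
      (by rw [minSmoothness_of_isRCLikeNormedField]; exact WithTop.coe_le_coe.2 (le_top (a := (2 : ℕ∞))))
    rw [fderiv_clm_apply h1 (differentiableAt_const _), fderiv_clm_apply h1 (differentiableAt_const _)]
    simpa using h2 v w
  rw [← neg_inj, ← integral_mul_fderiv_eq hf1 hfc (hdg1 w) v,
    ← integral_mul_fderiv_eq hf1 hfc (hdg1 v) w]
  simp_rw [hsym]

/-- The gradients of two test fields satisfy `∫ ∇u : (∇v)ᵀ = 0`. -/
theorem sum_integral_grad_mul_grad_swap (u v : TestField) :
    ∑ p : Fin 3 × Fin 3, ∫ x, grad u.field x p.1 p.2 * grad v.field x p.2 p.1 = 0 := by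
  -- Exchanging the two derivatives turns `∂ⱼuᵢ ∂ᵢvⱼ` into `∂ᵢuᵢ ∂ⱼvⱼ`, which sums to `div u · div
  -- v`.
  have h1 : ∀ p : Fin 3 × Fin 3, ∫ x, grad u.field x p.1 p.2 * grad v.field x p.2 p.1 =
      ∫ x, grad u.field x p.1 p.1 * grad v.field x p.2 p.2 := by
    intro p
    simp_rw [u.grad_eq_fderiv, v.grad_eq_fderiv]
    exact integral_fderiv_mul_fderiv_swap (u.contDiff_field _) (u.hasCompactSupport_field _)
      (v.contDiff_field _) _ _
  rw [Finset.sum_congr rfl fun p _ => h1 p, ← integral_finsetSum]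
  · rw [← integral_zero E3 ℝ]
    congr 1
    ext x
    rw [Fintype.sum_prod_type]
    have hd := u.isTestField.div_free x
    rw [Matrix.trace] at hd
    simp only [Matrix.diag_apply] at hd
    simp_rw [← Finset.mul_sum, ← Finset.sum_mul]
    rw [hd, zero_mul]
  · intro p _
    exact ((u.contDiff_grad _ _).continuous.mul (v.contDiff_grad _ _).continuous)
      |>.integrable_of_hasCompactSupport (u.hasCompactSupport_grad _ _).mul_right

/-! ### Gradient fields of elements of `GradSpace` -/

/-- The components of an element of `GradSpace`. -/
def comp (i j : Fin 3) : GradSpace →L[ℝ] Lp ℝ 2 (volume : Measure E3) :=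
  PiLp.proj 2 (𝕜 := ℝ) (fun _ : Fin 3 × Fin 3 => Lp ℝ 2 (volume : Measure E3)) (i, j) ∘L
    GradSpace.subtypeL

theorem coeFn_comp_gradK (u : TestField) (i j : Fin 3) :
    comp i j (gradK u) =ᵐ[volume] fun x => grad u.field x i j :=
  coeFn_gradL2 u i j

theorem inner_Lp_eq_integral {f g : E3 → ℝ} {F G : Lp ℝ 2 (volume : Measure E3)}
    (hf : F =ᵐ[volume] f) (hg : G =ᵐ[volume] g) : inner ℝ F G = ∫ x, f x * g x := by
  rw [L2.inner_def]
  refine integral_congr_ae ?_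
  filter_upwards [hf, hg] with x h1 h2
  rw [h1, h2]
  simp [mul_comm]

theorem inner_eq_sum_comp (g g' : GradSpace) :
    inner ℝ g g' = ∑ p : Fin 3 × Fin 3, inner ℝ (comp p.1 p.2 g) (comp p.1 p.2 g') := by
  rw [Submodule.coe_inner, PiLp.inner_apply]
  rfl

theorem sum_inner_comp_swap (g g' : GradSpace) :
    ∑ p : Fin 3 × Fin 3, inner ℝ (comp p.1 p.2 g) (comp p.2 p.1 g') = 0 := by
  refine denseRange_gradK.induction_on g (isClosed_eq ?_ continuous_const) fun u => ?_
  · exact continuous_finsetSum _ fun p _ => ((comp p.1 p.2).continuous).inner continuous_const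
  refine denseRange_gradK.induction_on g' (isClosed_eq ?_ continuous_const) fun v => ?_
  · exact continuous_finsetSum _ fun p _ => continuous_const.inner (comp p.2 p.1).continuous
  rw [← sum_integral_grad_mul_grad_swap u v]
  exact Finset.sum_congr rfl fun p _ =>
    inner_Lp_eq_integral (coeFn_comp_gradK u _ _) (coeFn_comp_gradK v _ _)

/-- The matrix field of an element of `GradSpace`. -/
def gradMat (g : GradSpace) (x : E3) : Matrix (Fin 3) (Fin 3) ℝ := Matrix.of fun i j => comp i j g x

theorem gradMat_gradK (u : TestField) : gradMat (gradK u) =ᵐ[volume] grad u.field := by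
  have h : ∀ᵐ x ∂(volume : Measure E3), ∀ p : Fin 3 × Fin 3,
      comp p.1 p.2 (gradK u) x = grad u.field x p.1 p.2 :=
    ae_all_iff.2 fun p => coeFn_comp_gradK u p.1 p.2
  filter_upwards [h] with x hx
  ext i j
  exact hx (i, j)

theorem two_mul_ddot_sym (A B : Matrix (Fin 3) (Fin 3) ℝ) :
    2 * ddot (sym A) (sym B) =
      ∑ p : Fin 3 × Fin 3, (A p.1 p.2 * B p.1 p.2 + A p.1 p.2 * B p.2 p.1) := by
  simp only [ddot, sym, Fintype.sum_prod_type, Fin.sum_univ_three, Matrix.smul_apply,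
    Matrix.add_apply, Matrix.transpose_apply, smul_eq_mul]
  ring

/-- Korn's identity: `2 sym A : sym B = A : B + A : Bᵀ`, and the transposed term integrates to zero
by `sum_inner_comp_swap`. -/
theorem two_mul_integral_ddot_sym (g g' : GradSpace) :
    2 * ∫ x, ddot (sym (gradMat g x)) (sym (gradMat g' x)) = inner ℝ g g' := by
  have hi : ∀ i j k l, Integrable fun x => comp i j g x * comp k l g' x := fun i j k l =>
    (Lp.memLp (comp i j g)).integrable_mul (Lp.memLp (comp k l g'))
  rw [← integral_const_mul]
  simp_rw [two_mul_ddot_sym]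
  rw [integral_finsetSum _ fun p _ => (hi p.1 p.2 p.1 p.2).add (hi p.1 p.2 p.2 p.1)]
  have h1 : ∀ p : Fin 3 × Fin 3, ∫ x, (gradMat g x p.1 p.2 * gradMat g' x p.1 p.2 +
      gradMat g x p.1 p.2 * gradMat g' x p.2 p.1) =
      inner ℝ (comp p.1 p.2 g) (comp p.1 p.2 g') + inner ℝ (comp p.1 p.2 g) (comp p.2 p.1 g') := by
    intro p
    rw [inner_Lp_eq_integral EventuallyEq.rfl EventuallyEq.rfl,
      inner_Lp_eq_integral EventuallyEq.rfl EventuallyEq.rfl]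
    exact integral_add (hi p.1 p.2 p.1 p.2) (hi p.1 p.2 p.2 p.1)
  rw [Finset.sum_congr rfl fun p _ => h1 p, Finset.sum_add_distrib, sum_inner_comp_swap, add_zero,
    inner_eq_sum_comp]

theorem sym_grad_rigid (a b x : E3) : sym (grad (rigid a b) x) = 0 := by
  let L : E3 →L[ℝ] E3 := LinearMap.toContinuousLinearMap
    ((WithLp.linearEquiv 2 ℝ (Fin 3 → ℝ)).symm.toLinearMap ∘ₗ crossProduct b.ofLp ∘ₗ
      (WithLp.linearEquiv 2 ℝ (Fin 3 → ℝ)).toLinearMap)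
  have h : HasFDerivAt (rigid a b) L x := L.hasFDerivAt.const_add a
  have hg : ∀ i j, grad (rigid a b) x i j = crossProduct b.ofLp (Pi.single j 1) i := by
    intro i j
    simp only [grad, Matrix.of_apply, h.fderiv]
    rfl
  ext i j
  simp only [sym, Matrix.smul_apply, Matrix.add_apply, Matrix.transpose_apply, hg, Matrix.zero_apply]
  fin_cases i <;> fin_cases j <;> simp [cross_apply]

theorem sym_grad_eq_zero_of_mem_body (u : TestField) {x : E3} (hx : x ∈ body) :
    sym (grad u.field x) = 0 := by
  have h : u.field =ᶠ[𝓝 x] rigid u.trans u.ang :=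
    (eventually_nhdsSet_iff_forall.1 u.isTestField.rigid_near) x hx
  have : grad u.field x = grad (rigid u.trans u.ang) x := by
    simp only [grad, h.fderiv_eq]
  rw [this, sym_grad_rigid]

/-- A test field is rigid near the body, where its symmetric gradient vanishes, so integrating over
the liquid or over the whole space is the same. -/
theorem two_mul_setIntegral_ddot_sym (g : GradSpace) (u : TestField) :
    2 * ∫ x in liquid, ddot (sym (gradMat g x)) (sym (grad u.field x)) = inner ℝ g (gradK u) := by
  rw [← two_mul_integral_ddot_sym, setIntegral_eq_integral_of_forall_compl_eq_zero]
  · congr 1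
    refine integral_congr_ae ?_
    filter_upwards [gradMat_gradK u] with x hx
    rw [hx]
  · intro x hx
    rw [sym_grad_eq_zero_of_mem_body u (by simpa [liquid] using hx)]
    simp [ddot]

/-- The pairing of a component of an `L⁶` field with a function in `L^(6/5)`. -/
def pairComp (f : Lp ℝ (6 / 5) (volume : Measure E3)) (i : Fin 3) :
    Lp E3 6 (volume : Measure E3) →L[ℝ] ℝ :=
  ((ContinuousLinearMap.mul ℝ ℝ).bilinearComp (ContinuousLinearMap.id ℝ ℝ)
    (EuclideanSpace.proj i : E3 →L[ℝ] ℝ)).lpPairing volume (6 / 5) 6 f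

theorem pairComp_apply {f : E3 → ℝ} (hf : MemLp f (6 / 5) volume) (i : Fin 3)
    {v : E3 → E3} {w : Lp E3 6 (volume : Measure E3)} (hw : w =ᵐ[volume] v) :
    pairComp (hf.toLp f) i w = ∫ x, v x i * f x := by
  rw [pairComp, ContinuousLinearMap.lpPairing_eq_integral]
  refine integral_congr_ae ?_
  filter_upwards [hf.coeFn_toLp, hw] with x h1 h2
  simp [h1, h2, mul_comm]

theorem hasWeakGrad_velocity (g : GradSpace) : HasWeakGrad (velocity g) (gradMat g) where
  locInt := (Lp.memLp (velocity g)).locallyIntegrable (by norm_num)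
  locInt_grad i j := (Lp.memLp (comp i j g)).locallyIntegrable (by norm_num)
  byParts ψ hψ hψc i j := by
    have hψ1 : ContDiff ℝ 1 ψ := hψ.of_le (by exact_mod_cast le_top)
    have hd : Continuous fun x => fderiv ℝ ψ x (e j) :=
      (hψ1.continuous_fderiv one_ne_zero).clm_apply continuous_const
    have hdm : MemLp (fun x => fderiv ℝ ψ x (e j)) (6 / 5) volume :=
      hd.memLp_of_hasCompactSupport (hψc.fderiv_apply (𝕜 := ℝ) (e j))
    have hψm : MemLp ψ 2 volume := hψ.continuous.memLp_of_hasCompactSupport hψc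
    -- In this form both sides are continuous in `g`, and density reduces the claim to classical
    -- integration by parts.
    have key : pairComp (hdm.toLp _) i (velocity g) = - inner ℝ (comp i j g) (hψm.toLp ψ) := by
      refine denseRange_gradK.induction_on g (isClosed_eq ?_ ?_) fun u => ?_
      · exact (pairComp _ i).continuous.comp velocity.continuous
      · exact ((comp i j).continuous.inner continuous_const).neg
      · rw [velocity_gradK, pairComp_apply hdm i (coeFn_toL6 u),
          inner_Lp_eq_integral (coeFn_comp_gradK u i j) hψm.coeFn_toLp,
          integral_mul_fderiv_eq ((u.contDiff_field i).of_le (by exact_mod_cast le_top))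
            (u.hasCompactSupport_field i) hψ1]
        simp_rw [u.grad_eq_fderiv]
    rw [pairComp_apply hdm i EventuallyEq.rfl,
      inner_Lp_eq_integral EventuallyEq.rfl hψm.coeFn_toLp] at key
    exact key

theorem memV_velocity (g : GradSpace) : MemV (velocity g) := by
  refine ⟨Lp.memLp _, gradMat g, hasWeakGrad_velocity g, fun i j => Lp.memLp (comp i j g), ?_⟩
  obtain ⟨x, hx, hlim⟩ := mem_closure_iff_seq_limit.1 (denseRange_gradK g)
  choose u hu using hx
  refine ⟨fun n => (u n).field, fun n => ⟨_, _, (u n).isTestField⟩, ?_, fun i j => ?_⟩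
  · have h1 : ∀ n, eLpNorm (fun x => velocity g x - (u n).field x) 6 volume =
        ‖velocity g - velocity (x n)‖ₑ := by
      intro n
      rw [Lp.enorm_def, ← hu, velocity_gradK]
      refine eLpNorm_congr_ae ?_
      filter_upwards [Lp.coeFn_sub (velocity g) (toL6 (u n)), coeFn_toL6 (u n)] with y h1 h2
      rw [h1, Pi.sub_apply, h2]
    simp_rw [h1]
    have h2 : Tendsto (fun n => ‖velocity g - velocity (x n)‖ₑ) atTop
        (𝓝 ‖velocity g - velocity g‖ₑ) :=
      (continuous_enorm.tendsto _).comp (((velocity.continuous.tendsto g).comp hlim).const_sub _)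
    simpa using h2
  · let c : GradSpace →L[ℝ] Lp ℝ 2 (volume : Measure E3) := (1 / 2 : ℝ) • (comp i j + comp j i)
    have h1 : ∀ n, eLpNorm (fun x => sym (gradMat g x) i j - sym (grad (u n).field x) i j) 2 volume =
        ‖c (g - x n)‖ₑ := by
      intro n
      rw [Lp.enorm_def, ← hu]
      refine eLpNorm_congr_ae ?_
      have hc : c (g - gradK (u n)) = (1 / 2 : ℝ) •
          ((comp i j g + comp j i g) - (comp i j (gradK (u n)) + comp j i (gradK (u n)))) := by
        rw [map_sub, smul_sub]
        rfl
      rw [hc]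
      filter_upwards [Lp.coeFn_smul (1 / 2 : ℝ)
          ((comp i j g + comp j i g) - (comp i j (gradK (u n)) + comp j i (gradK (u n)))),
        Lp.coeFn_sub (comp i j g + comp j i g) (comp i j (gradK (u n)) + comp j i (gradK (u n))),
        Lp.coeFn_add (comp i j g) (comp j i g),
        Lp.coeFn_add (comp i j (gradK (u n))) (comp j i (gradK (u n))),
        coeFn_comp_gradK (u n) i j, coeFn_comp_gradK (u n) j i] with y h1 h2 h3 h4 h5 h6
      rw [h1, Pi.smul_apply, h2, Pi.sub_apply, h3, h4, Pi.add_apply, Pi.add_apply, h5, h6]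
      simp [sym, gradMat]
      ring
    simp_rw [h1]
    have h2 : Tendsto (fun n => ‖c (g - x n)‖ₑ) atTop (𝓝 ‖c (g - g)‖ₑ) :=
      (continuous_enorm.tendsto _).comp ((c.continuous.tendsto _).comp (hlim.const_sub _))
    simpa using h2

/-! ### The convective term -/

/-- The pointwise convective term `(A (y)) ⋅ z`. -/
def convTerm (A : Matrix (Fin 3) (Fin 3) ℝ) (y z : E3) : ℝ := (A *ᵥ y.ofLp) ⬝ᵥ z.ofLp

theorem convTerm_eq_sum (A : Matrix (Fin 3) (Fin 3) ℝ) (y z : E3) :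
    convTerm A y z = ∑ p : Fin 3 × Fin 3, A p.1 p.2 * y p.2 * z p.1 := by
  simp only [convTerm, Matrix.mulVec, dotProduct, Fintype.sum_prod_type, Finset.sum_mul]

theorem integrable_convTerm (u w φ : TestField) :
    Integrable fun x => convTerm (grad u.field x) (w.trans - w.field x) (φ.field x) := by
  simp_rw [convTerm_eq_sum]
  refine integrable_finsetSum _ fun p _ => ?_
  have h1 : Continuous fun x => (w.trans - w.field x) p.2 :=
    continuous_const.sub (w.contDiff_field p.2).continuous
  exact (((u.contDiff_grad p.1 p.2).continuous.mul h1).mul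
    (φ.contDiff_field p.1).continuous).integrable_of_hasCompactSupport
    (φ.hasCompactSupport_field p.1).mul_left

/-- The trilinear convective form on test fields. -/
def convForm (c : ℝ) : TestField →ₗ[ℝ] TestField →ₗ[ℝ] TestField →ₗ[ℝ] ℝ :=
  LinearMap.mk₂ ℝ (fun u w =>
    { toFun := fun φ => c * ∫ x, convTerm (grad u.field x) (w.trans - w.field x) (φ.field x)
      map_add' := fun φ ψ => by
        rw [← mul_add, ← integral_add (integrable_convTerm u w φ) (integrable_convTerm u w ψ)]
        congr 2
        ext x
        exact dotProduct_add _ _ _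
      map_smul' := fun a φ => by
        rw [RingHom.id_apply, smul_eq_mul, mul_left_comm]
        congr 1
        rw [← integral_const_mul]
        congr 1
        ext x
        exact dotProduct_smul _ _ _ })
    (fun u u' w => by
      ext φ
      change c * _ = c * _ + c * _
      rw [← mul_add, ← integral_add (integrable_convTerm u w φ) (integrable_convTerm u' w φ)]
      congr 2
      ext x
      have : grad (u + u').field x = grad u.field x + grad u'.field x :=
        grad_add u.differentiable u'.differentiable x
      rw [this, convTerm, Matrix.add_mulVec, add_dotProduct]
      rfl)
    (fun a u w => by
      ext φ
      change c * _ = a * (c * _)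
      rw [mul_left_comm]
      congr 1
      rw [← integral_const_mul]
      congr 1
      ext x
      have : grad (a • u).field x = a • grad u.field x := grad_const_smul a x
      rw [this, convTerm, Matrix.smul_mulVec, smul_dotProduct]
      rfl)
    (fun u w w' => by
      ext φ
      change c * _ = c * _ + c * _
      rw [← mul_add, ← integral_add (integrable_convTerm u w φ) (integrable_convTerm u w' φ)]
      congr 2
      ext x
      have : (w + w').trans - (w + w').field x = (w.trans - w.field x) + (w'.trans - w'.field x) := by
        change (w.trans + w'.trans) - (w.field x + w'.field x) = _
        abel
      rw [this, convTerm, WithLp.ofLp_add, Matrix.mulVec_add, add_dotProduct]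
      rfl)
    (fun a u w => by
      ext φ
      change c * _ = a * (c * _)
      rw [mul_left_comm]
      congr 1
      rw [← integral_const_mul]
      congr 1
      ext x
      have : (a • w).trans - (a • w).field x = a • (w.trans - w.field x) := by
        change a • w.trans - a • w.field x = _
        rw [smul_sub]
      rw [this, convTerm, WithLp.ofLp_smul, Matrix.mulVec_smul, smul_dotProduct]
      rfl)

theorem convForm_apply (c : ℝ) (u w φ : TestField) : convForm c u w φ =
    c * ∫ x, convTerm (grad u.field x) (w.trans - w.field x) (φ.field x) := rfl

/-- The convective form does not contribute to the energy balance. -/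
theorem convForm_self (c : ℝ) (u : TestField) : convForm c u u u = 0 := by
  have hu : ∀ i, ContDiff ℝ 1 fun x => u.field x i := fun i =>
    (u.contDiff_field i).of_le (by exact_mod_cast le_top)
  let q : E3 → ℝ := fun x => ∑ i, u.field x i ^ 2
  -- The flux `(τ - u)|u|²` is compactly supported, and as `div u = 0` its divergence is twice the
  -- convective integrand.
  let G : Fin 3 → E3 → ℝ := fun j x => (u.trans j - u.field x j) * q x
  have hq : ContDiff ℝ 1 q := ContDiff.sum fun i _ => (hu i).pow 2
  have hG : ∀ j, ContDiff ℝ 1 (G j) := fun j => (contDiff_const.sub (hu j)).mul hq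
  have hqc : HasCompactSupport q :=
    u.isTestField.compact.comp_left (g := fun y : E3 => ∑ i, y i ^ 2) (by simp)
  have hGc : ∀ j, HasCompactSupport (G j) := fun j => hqc.mul_left
  have hGd : ∀ j x, fderiv ℝ (G j) x (e j) = - grad u.field x j j * q x +
      (u.trans j - u.field x j) * ∑ i, 2 * u.field x i * grad u.field x i j := by
    intro j x
    have h1 : ∀ i, HasFDerivAt (fun x => u.field x i) (fderiv ℝ (fun x => u.field x i) x) x :=
      fun i => ((hu i).differentiable one_ne_zero x).hasFDerivAt
    have h2 := ((h1 j).const_sub (u.trans j)).mul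
      (HasFDerivAt.fun_sum (u := Finset.univ) fun i _ => (h1 i).pow 2)
    rw [HasFDerivAt.fderiv (f := G j) h2]
    simp only [u.grad_eq_fderiv]
    simp [q, Fin.sum_univ_three]
    ring
  have hsum : ∫ x, ∑ j, fderiv ℝ (G j) x (e j) = 0 := by
    rw [integral_finsetSum]
    · exact Finset.sum_eq_zero fun j _ => integral_fderiv_apply_eq_zero (hG j) (hGc j) _
    · intro j _
      exact (((hG j).continuous_fderiv one_ne_zero).clm_apply
        continuous_const).integrable_of_hasCompactSupport ((hGc j).fderiv_apply (𝕜 := ℝ) _)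
  have hpt : ∀ x, ∑ j, fderiv ℝ (G j) x (e j) =
      2 * convTerm (grad u.field x) (u.trans - u.field x) (u.field x) := by
    intro x
    have hd := u.isTestField.div_free x
    rw [Matrix.trace] at hd
    simp only [Matrix.diag_apply, Fin.sum_univ_three] at hd
    simp only [hGd, convTerm_eq_sum, Fintype.sum_prod_type, Fin.sum_univ_three, PiLp.sub_apply]
    linear_combination (- q x) * hd
  simp_rw [hpt] at hsum
  rw [integral_const_mul] at hsum
  rw [convForm_apply, (mul_eq_zero.1 hsum).resolve_left two_ne_zero, mul_zero]

/-- The convective form on `GradSpace`, in terms of the inner product of `L²`. -/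
def convLim (g : GradSpace) (φ : TestField) : ℝ :=
  ∑ p : Fin 3 × Fin 3,
    ((charVec g).1 p.2 * inner ℝ (comp p.1 p.2 g)
        (((φ.contDiff_field p.1).continuous.memLp_of_hasCompactSupport
          (φ.hasCompactSupport_field p.1) (p := 2) (μ := volume)).toLp _) -
      inner ℝ (comp p.1 p.2 g)
        (mulComp (((φ.contDiff_field p.1).continuous.memLp_of_hasCompactSupport
          (φ.hasCompactSupport_field p.1)).toLp _) p.2 (velocity g)))

/-- The weight `φᵢ` is grouped with the velocity: `φᵢ vⱼ` lies in `L²` by Hölder with exponents `3`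
and `6`, so each term pairs a gradient component with an `L²` function. -/
theorem integral_convTerm_eq (g : GradSpace) (φ : TestField) :
    ∫ x, convTerm (gradMat g x) ((charVec g).1 - velocity g x) (φ.field x) = convLim g φ := by
  simp_rw [convTerm_eq_sum]
  have hφ : ∀ i (r : ENNReal), MemLp (fun x => φ.field x i) r volume := fun i r =>
    (φ.contDiff_field i).continuous.memLp_of_hasCompactSupport (φ.hasCompactSupport_field i)
  have h1 : ∀ i j, Integrable fun x => comp i j g x * φ.field x i := fun i j =>
    (Lp.memLp (comp i j g)).integrable_mul (hφ i 2)
  have hm : ∀ i j, mulComp ((hφ i 3).toLp _) j (velocity g) =ᵐ[volume]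
      fun x => φ.field x i * velocity g x j := by
    intro i j
    refine (coeFn_mulComp _ _ _).trans ?_
    filter_upwards [(hφ i 3).coeFn_toLp] with x hx
    rw [hx]
  have h2 : ∀ i j, Integrable fun x => comp i j g x * (φ.field x i * velocity g x j) := fun i j =>
    (Lp.memLp (comp i j g)).integrable_mul ((Lp.memLp _).ae_eq (hm i j))
  have hpt : ∀ (p : Fin 3 × Fin 3) x, gradMat g x p.1 p.2 * ((charVec g).1 - velocity g x) p.2 *
      φ.field x p.1 = (charVec g).1 p.2 * (comp p.1 p.2 g x * φ.field x p.1) -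
        comp p.1 p.2 g x * (φ.field x p.1 * velocity g x p.2) := by
    intro p x
    simp only [gradMat, Matrix.of_apply, PiLp.sub_apply]
    ring
  simp_rw [hpt]
  rw [integral_finsetSum _ fun p _ => ((h1 p.1 p.2).const_mul _).sub (h2 p.1 p.2), convLim]
  refine Finset.sum_congr rfl fun p _ => ?_
  rw [integral_sub ((h1 p.1 p.2).const_mul _) (h2 p.1 p.2), integral_const_mul,
    inner_Lp_eq_integral EventuallyEq.rfl (hφ p.1 2).coeFn_toLp,
    inner_Lp_eq_integral EventuallyEq.rfl (hm p.1 p.2)]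

theorem convForm_eq_convLim (c : ℝ) (u φ : TestField) :
    convForm c u u φ = c * convLim (gradK u) φ := by
  rw [convForm_apply, ← integral_convTerm_eq, charVec_gradK]
  congr 1
  refine integral_congr_ae ?_
  rw [velocity_gradK]
  filter_upwards [gradMat_gradK u, coeFn_toL6 u] with x h1 h2
  rw [h1, h2]

theorem WeakTendsto.inner_comp {I : Type*} {x : I → GradSpace} {U : Filter I} {g : GradSpace}
    (hx : WeakTendsto x U g) (i j : Fin 3) (f : Lp ℝ 2 (volume : Measure E3)) :
    Tendsto (fun k => inner ℝ (comp i j (x k)) f) U (𝓝 (inner ℝ (comp i j g) f)) := by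
  have := hx ((innerSL ℝ f).comp (comp i j))
  simp_rw [real_inner_comm f]
  exact this

/-- Weak times strong convergence: the error from `f k - f₀` is at most `M * ‖f k - f₀‖`. -/
theorem WeakTendsto.inner_comp_of_tendsto {I : Type*} {x : I → GradSpace} {U : Filter I}
    {g : GradSpace} (hx : WeakTendsto x U g) {M : ℝ} (hM : ∀ i, ‖x i‖ ≤ M) (i j : Fin 3)
    {f : I → Lp ℝ 2 (volume : Measure E3)} {f₀ : Lp ℝ 2 (volume : Measure E3)}
    (hf : Tendsto f U (𝓝 f₀)) :
    Tendsto (fun k => inner ℝ (comp i j (x k)) (f k)) U (𝓝 (inner ℝ (comp i j g) f₀)) := by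
  have h1 : Tendsto (fun k => inner ℝ (comp i j (x k)) (f k - f₀)) U (𝓝 0) := by
    refine squeeze_zero_norm (a := fun k => M * ‖f k - f₀‖) (fun k => ?_) ?_
    · refine (norm_inner_le_norm _ _).trans ?_
      gcongr
      exact (PiLp.norm_apply_le (x k : MatL2) (i, j)).trans (hM k)
    · have := (tendsto_iff_norm_sub_tendsto_zero.1 hf).const_mul M
      rwa [mul_zero] at this
  have h2 := h1.add (hx.inner_comp i j f₀)
  simpa only [← inner_add_right, sub_add_cancel, zero_add] using h2

theorem tendsto_convLim {I : Type*} {x : I → GradSpace} {U : Filter I} {g : GradSpace}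
    (hx : WeakTendsto x U g) {M : ℝ} (hM : ∀ i, ‖x i‖ ≤ M) (φ : TestField) :
    Tendsto (fun i => convLim (x i) φ) U (𝓝 (convLim g φ)) := by
  refine tendsto_finsetSum _ fun p _ => Tendsto.sub (Tendsto.mul ?_ ?_) ?_
  · have := hx.apply (ContinuousLinearMap.fst ℝ E3 E3 ∘L charVec)
    exact ((EuclideanSpace.proj p.2 : E3 →L[ℝ] ℝ).continuous.tendsto _).comp this
  · exact hx.inner_comp _ _ _
  · exact hx.inner_comp_of_tendsto hM _ _ (hx.mulComp hM (φ.contDiff_field p.1).continuous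
      (φ.hasCompactSupport_field p.1) p.2)

/-! ### A test field with prescribed translational velocity -/

/-- The radial cut-off profile. -/
def cutoff (s : ℝ) : ℝ := Real.smoothTransition (3 - s)

theorem contDiff_cutoff : ContDiff ℝ ∞ cutoff :=
  Real.smoothTransition.contDiff.comp (contDiff_const.sub contDiff_id)

theorem contDiff_deriv_cutoff : ContDiff ℝ ∞ (deriv cutoff) :=
  (contDiff_infty_iff_deriv.1 contDiff_cutoff).2

theorem cutoff_eq_one {s : ℝ} (hs : s < 2) : cutoff s = 1 :=
  Real.smoothTransition.one_of_one_le (by linarith)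

theorem cutoff_eq_zero {s : ℝ} (hs : 3 < s) : cutoff s = 0 :=
  Real.smoothTransition.zero_of_nonpos (by linarith)

theorem deriv_cutoff_eq_zero_of_lt {s : ℝ} (hs : s < 2) : deriv cutoff s = 0 := by
  have : cutoff =ᶠ[𝓝 s] fun _ => 1 := by
    filter_upwards [gt_mem_nhds hs] with t ht using cutoff_eq_one ht
  rw [this.deriv_eq, deriv_const]

theorem deriv_cutoff_eq_zero_of_gt {s : ℝ} (hs : 3 < s) : deriv cutoff s = 0 := by
  have : cutoff =ᶠ[𝓝 s] fun _ => 0 := by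
    filter_upwards [lt_mem_nhds hs] with t ht using cutoff_eq_zero ht
  rw [this.deriv_eq, deriv_const]

/-- The curl of the truncated potential `cutoff (|x|²) (e₁ × x) / 2`. -/
def translationField (x : E3) : E3 :=
  (cutoff (‖x‖ ^ 2) + ‖x‖ ^ 2 * deriv cutoff (‖x‖ ^ 2)) • e 0 -
    (deriv cutoff (‖x‖ ^ 2) * x 0) • x

theorem trace_grad_translationField (x : E3) : (grad translationField x).trace = 0 := by
  have hd : ∀ s, HasDerivAt cutoff (deriv cutoff s) s := fun s =>
    (contDiff_cutoff.differentiable (by simp) s).hasDerivAt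
  have hd' : ∀ s, HasDerivAt (deriv cutoff) (deriv (deriv cutoff) s) s := fun s =>
    (contDiff_deriv_cutoff.differentiable (by simp) s).hasDerivAt
  have hs : HasFDerivAt (fun x : E3 => ‖x‖ ^ 2) (2 • innerSL ℝ x) x :=
    (hasStrictFDerivAt_norm_sq x).hasFDerivAt
  have h0 : HasFDerivAt (fun x : E3 => x 0) (EuclideanSpace.proj 0 : E3 →L[ℝ] ℝ) x :=
    (EuclideanSpace.proj 0 : E3 →L[ℝ] ℝ).hasFDerivAt
  have h1 := (hd (‖x‖ ^ 2)).comp_hasFDerivAt x hs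
  have h2 := (hd' (‖x‖ ^ 2)).comp_hasFDerivAt x hs
  have h3 : HasFDerivAt translationField _ x :=
    ((h1.add (hs.mul h2)).smul_const (e 0)).sub ((h2.mul h0).smul (hasFDerivAt_id x))
  have hi : ∀ i, inner ℝ x (EuclideanSpace.single i (1 : ℝ)) = x i := fun i => by
    simp [EuclideanSpace.inner_single_right]
  have hn : ‖x‖ ^ 2 = x 0 ^ 2 + x 1 ^ 2 + x 2 ^ 2 := by
    rw [EuclideanSpace.norm_sq_eq, Fin.sum_univ_three]
    simp
  -- With `s = |x|²` and `χ` the cut-off, both summands of the field have divergence `(4χ'(s) +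
  -- 2sχ''(s)) x₀`, so the difference cancels.
  rw [Matrix.trace, Fin.sum_univ_three]
  simp only [Matrix.diag_apply, grad, Matrix.of_apply, h3.fderiv]
  simp [hi, e]
  rw [hn]
  ring

theorem isTestField_translationField : IsTestField translationField (e 0) 0 where
  smooth := by
    have h0 : ContDiff ℝ ∞ fun x : E3 => x 0 := (EuclideanSpace.proj 0 : E3 →L[ℝ] ℝ).contDiff
    have hs : ContDiff ℝ ∞ fun x : E3 => ‖x‖ ^ 2 := contDiff_norm_sq ℝ
    have h2 := contDiff_deriv_cutoff.comp hs
    exact (((contDiff_cutoff.comp hs).add (hs.mul h2)).smul contDiff_const).sub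
      ((h2.mul h0).smul contDiff_id)
  compact := by
    refine HasCompactSupport.intro (isCompact_closedBall (0 : E3) 2) fun x hx => ?_
    have hx' : 2 < ‖x‖ := by simpa using hx
    have : 3 < ‖x‖ ^ 2 := by nlinarith
    simp [translationField, cutoff_eq_zero this, deriv_cutoff_eq_zero_of_gt this]
  rigid_near := by
    have ho : IsOpen {x : E3 | ‖x‖ ^ 2 < 2} := isOpen_lt (by fun_prop) continuous_const
    have hb : body ⊆ {x : E3 | ‖x‖ ^ 2 < 2} := by
      intro x hx
      have hx' : ‖x‖ ≤ 1 := by simpa [body] using hx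
      have := norm_nonneg x
      change ‖x‖ ^ 2 < 2
      nlinarith
    filter_upwards [ho.mem_nhdsSet.2 hb] with x hx
    have hx : ‖x‖ ^ 2 < 2 := hx
    simp [translationField, cutoff_eq_one hx, deriv_cutoff_eq_zero_of_lt hx, rigid]
  div_free := trace_grad_translationField

/-! ### Existence -/

theorem exists_gradSpace_solution (lam : ℝ) :
    ∃ g : GradSpace, ‖g‖ ^ 2 ≤ lam * inner ℝ (charVec g).1 (e 0) ∧
      ∀ φ : TestField, inner ℝ g (gradK φ) = lam * inner ℝ φ.trans (e 0) + lam * convLim g φ := by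
  let Λ : GradSpace →L[ℝ] ℝ := lam • (innerSL ℝ (e 0) ∘L ContinuousLinearMap.fst ℝ E3 E3 ∘L charVec)
  have hΛ : ∀ g, Λ g = lam * inner ℝ (charVec g).1 (e 0) := fun g => by
    rw [real_inner_comm]; rfl
  obtain ⟨U, u, g, hen, hbd, heq, hweak⟩ := exists_galerkin_limit gradK gradK_injective
    (Λ.toLinearMap ∘ₗ gradK) (norm_nonneg Λ) (fun φ => Λ.le_opNorm (gradK φ)) (convForm lam)
    (convForm_self lam)
  have hw : WeakTendsto (fun S => gradK (u S)) U g := hweak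
  have hen' : ∀ S, ‖gradK (u S)‖ ^ 2 = Λ (gradK (u S)) := hen
  have hinner : ∀ k : GradSpace, Tendsto (fun S => inner ℝ (gradK (u S)) k) U (𝓝 (inner ℝ g k)) := by
    intro k
    have := hw (innerSL ℝ k)
    simp_rw [real_inner_comm k]
    exact this
  refine ⟨g, ?_, fun φ => ?_⟩
  · rw [← hΛ]
    -- From `2⟪u, g⟫ ≤ ‖u‖² + ‖g‖²` and the energy equality. Both sides are weakly continuous in
    -- `u`, so the limit gives `‖g‖² ≤ Λ g`.
    have h1 : ∀ S, inner ℝ (gradK (u S)) g ≤ (Λ (gradK (u S)) + ‖g‖ ^ 2) / 2 := fun S => by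
      have h2 := norm_sub_sq_real (gradK (u S)) g
      rw [hen'] at h2
      nlinarith [sq_nonneg ‖gradK (u S) - g‖]
    have h2 := le_of_tendsto_of_tendsto' (hinner g) (((hw Λ).add_const (‖g‖ ^ 2)).div_const 2) h1
    rw [real_inner_self_eq_norm_sq] at h2
    linarith
  · have h1 : Tendsto (fun S => Λ (gradK φ) + lam * convLim (gradK (u S)) φ) U
        (𝓝 (Λ (gradK φ) + lam * convLim g φ)) :=
      ((tendsto_convLim hw hbd φ).const_mul lam).const_add _
    have h2 := tendsto_nhds_unique (Tendsto.congr' ?_ (hinner (gradK φ))) h1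
    · rw [h2, hΛ, charVec_gradK]
    · filter_upwards [heq φ] with S hS
      rw [hS, convForm_eq_convLim]
      rfl

theorem convLim_zero (φ : TestField) : convLim 0 φ = 0 := by
  simp [convLim]

end

end FreeFall


open FreeFall in
theorem theorem4p1 (lam : ℝ) (hlam : 0 < lam) :
    ∃ (v : FreeFall.E3 → FreeFall.E3)
      (G : FreeFall.E3 → Matrix (Fin 3) (Fin 3) ℝ) (τ om : FreeFall.E3),
      FreeFall.IsWeakSolution lam v G τ om ∧
      2 * (∫ x, FreeFall.ddot (FreeFall.sym (G x)) (FreeFall.sym (G x))) ≤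
        lam * inner ℝ τ (FreeFall.e 0) := by
  obtain ⟨g, hen, hg⟩ := exists_gradSpace_solution lam
  refine ⟨velocity g, gradMat g, (charVec g).1, (charVec g).2,
    ⟨memV_velocity g, hasWeakGrad_velocity g, hasCharVectors_velocity g, fun h0 => ?_,
      fun φ a b hφ => ?_⟩, ?_⟩
  -- With `τ = 0` the energy inequality reads `‖g‖² ≤ 0`, and testing the equation with
  -- `translationField` then leaves `0 = lam`.
  · have hg0 : g = 0 := by
      rw [h0, inner_zero_left, mul_zero] at hen
      exact norm_eq_zero.1 (pow_eq_zero_iff two_ne_zero |>.1 (le_antisymm hen (sq_nonneg _)))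
    let w : TestField := ⟨(translationField, e 0, 0), isTestField_translationField⟩
    have h1 := hg w
    have h2 : inner ℝ w.trans (e 0) = (1 : ℝ) := by
      change inner ℝ (e 0) (e 0) = (1 : ℝ)
      simp [e]
    rw [hg0, inner_zero_left, convLim_zero, h2] at h1
    linarith
  · let w : TestField := ⟨(φ, a, b), hφ⟩
    have h1 := two_mul_setIntegral_ddot_sym g w
    rw [hg w, ← integral_convTerm_eq] at h1
    exact sub_eq_iff_eq_add'.2 h1
  · rw [two_mul_integral_ddot_sym, real_inner_self_eq_norm_sq]
    exact hen
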